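/- For a finite group $G$, the commuting conjugacy class graph $\Gamma_G$ is the simple graph whose vertices are the conjugacy classes $x^G$ of the non-central elements $x\in G$; two distinct vertices $x^G,y^G$ are adjacent iff $x'y'=y'x'$ for some $x'\in x^G$, $y'\in y^G$. For a finite graph $\mathcal G$ with vertices $v_1,\dots,v_N$, let $CN(\mathcal G)$ be the $N\times N$ matrix with zero diagonal whose $(i,j)$ entry, $i\ne j$, is the number of common neighbours of $v_i$ and $v_j$; let $CNRS(\mathcal G)$ be the diagonal matrix of the row sums of $CN(\mathcal G)$, and $\Delta(\mathcal G)=\operatorname{tr}(CNRS(\mathcal G))/N$. The CNL-energy $LE_{CN}(\mathcal G)$ (respectively the CNSL-energy $LE^+_{CN}(\mathcal G)$) is $\sum_\alpha|\alpha-\Delta(\mathcal G)|$ over the eigenvalues $\alpha$, with multiplicity, of $CNRS(\mathcal G)-CN(\mathcal G)$ (respectively of $CNRS(\mathcal G)+CN(\mathcal G)$). A graph $\mathcal G$ on $N$ vertices is CNL-hyperenergetic if $LE_{CN}(\mathcal G)>LE_{CN}(K_N)$ and CNL-borderenergetic if $LE_{CN}(\mathcal G)=LE_{CN}(K_N)$;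 CNSL-hyperenergetic and CNSL-borderenergetic are defined likewise with $LE^+_{CN}$. Here $LE_{CN}(K_N)=LE^+_{CN}(K_N)=2(N-1)(N-2)$ for $N\ge1$; for the graph without vertices ($N=0$) all energies are empty sums, equal to $0$. Consider the groups - $D_{2n}=\langle x,y: x^n=y^2=1,\ yxy^{-1}=x^{-1}\rangle$, $n\ge3$; - $T_{4n}=\langle x,y: x^{2n}=1,\ x^n=y^2,\ y^{-1}xy=x^{-1}\rangle$, $n\ge2$; - $U_{6n}=\langle x,y: x^{2n}=y^3=1,\ x^{-1}yx=y^{-1}\rangle$, $n\ge2$; - $SD_{8n}=\langle x,y: x^{4n}=y^2=1,\ yxy=x^{2n-1}\rangle$, $n\ge2$; - $U_{(n,m)}=\langle x,y: x^{2n}=y^m=1,\ x^{-1}yx=y^{-1}\rangle$, $n\ge2$, $m\ge2$. Then, for $G$ any member of these families: 1. $\Gamma_G$ is CNL-borderenergetic if and only if $G$ is $D_6$, $D_{22}$, or $U_{(n,2)}$ with $n\ge2$. 2. $\Gamma_G$ is CNL-hyperenergetic if and only if $G$ is $D_{2n}$ with $n\ge13$; $T_{4n}$ with $n\ge7$; $SD_{8n}$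 with $n\ge4$; or $U_{(n,m)}$ with $(n,m)$ not among: $m\in\{2,3,4,6\}$ (any $n\ge2$); $m=5$ and $n\in\{2,3\}$; $m=8$ and $n=2$. 3. $\Gamma_G$ is CNSL-borderenergetic if and only if $G$ is $D_6$, or $U_{(n,2)}$ with $n\ge2$. 4. $\Gamma_G$ is CNSL-hyperenergetic if and only if $G$ is $D_{2n}$ with $n$ even and $n\ge20$; $T_{4n}$ with $n\ge10$; $SD_{8n}$ with $n\ge6$; or $U_{(n,m)}$ with $(n,m)$ not among: $m\in\{2,3,4,6\}$ (any $n\ge2$); $m\in\{5,7,9\}$ and $n=2$; $m=5$ and $n\in\{3,4\}$; $m\in\{8,10\}$ and $n=2$. In particular, no $\Gamma_{U_{6n}}$ with $n\ge2$ has any of the four properties. (The groups $U_{(n,2)}$ are abelian, so their graphs $\Gamma_G$ have no vertices.) As always in such lists, "$G$ is $D_{2n}$ with …" is meant family by family: a member of a family has the property exactly for the listed parameters of that family. -/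

import Mathlib

namespace CCC

section Graph

variable {V : Type*} [Fintype V]

open Classical in
/-- The common neighbourhood matrix of a graph: the `(i, j)` entry is the number of common
neighbours of `i` and `j` when `i ≠ j`, and `0` when `i = j`. -/
noncomputable def cnMatrix (G : SimpleGraph V) : Matrix V V ℝ :=
  Matrix.of fun i j => if i = j then 0 else ((G.commonNeighbors i j).ncard : ℝ)

open Classical in
/-- The diagonal matrix of the row sums of the common neighbourhood matrix. -/
noncomputable def cnrsMatrix (G : SimpleGraph V) : Matrix V V ℝ :=
  Matrix.diagonal fun i => ∑ k, cnMatrix G i k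

/-- The common neighbourhood Laplacian matrix. -/
noncomputable def cnlMatrix (G : SimpleGraph V) : Matrix V V ℝ :=
  cnrsMatrix G - cnMatrix G

/-- The common neighbourhood signless Laplacian matrix. -/
noncomputable def cnslMatrix (G : SimpleGraph V) : Matrix V V ℝ :=
  cnrsMatrix G + cnMatrix G

/-- The average `Δ(G)` of the row sums of the common neighbourhood matrix. For a graph without
vertices this is the junk value `0 / 0`, but it is then never used (see `deviation`). -/
noncomputable def cnMean (G : SimpleGraph V) : ℝ :=
  (cnrsMatrix G).trace / (Fintype.card V : ℝ)

open Classical in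
/-- The multiset of eigenvalues of a real square matrix, with multiplicities. All the matrices used
here are symmetric, so that all their eigenvalues are real. -/
noncomputable def spectrumMultiset (M : Matrix V V ℝ) : Multiset ℝ :=
  M.charpoly.roots

/-- The sum of `|α - c|` over the eigenvalues `α` of `M`, counted with multiplicity; it is an empty
sum if the index set is empty. -/
noncomputable def deviation (M : Matrix V V ℝ) (c : ℝ) : ℝ :=
  ((spectrumMultiset M).map fun α => |α - c|).sum

/-- The common neighbourhood Laplacian energy of a graph. -/
noncomputable def cnlEnergy (G : SimpleGraph V) : ℝ :=
  deviation (cnlMatrix G) (cnMean G)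

/-- The common neighbourhood signless Laplacian energy of a graph. -/
noncomputable def cnslEnergy (G : SimpleGraph V) : ℝ :=
  deviation (cnslMatrix G) (cnMean G)

/-- The CNL-energy exceeds that of the complete graph on the same vertices. -/
def IsCNLHyperenergetic (G : SimpleGraph V) : Prop :=
  cnlEnergy (⊤ : SimpleGraph V) < cnlEnergy G

/-- The CNL-energy equals that of the complete graph on the same vertices. -/
def IsCNLBorderenergetic (G : SimpleGraph V) : Prop :=
  cnlEnergy G = cnlEnergy (⊤ : SimpleGraph V)

/-- The CNSL-energy exceeds that of the complete graph on the same vertices. -/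
def IsCNSLHyperenergetic (G : SimpleGraph V) : Prop :=
  cnslEnergy (⊤ : SimpleGraph V) < cnslEnergy G

/-- The CNSL-energy equals that of the complete graph on the same vertices. -/
def IsCNSLBorderenergetic (G : SimpleGraph V) : Prop :=
  cnslEnergy G = cnslEnergy (⊤ : SimpleGraph V)

/- On a nonempty vertex set of `N` elements, the energies of the complete graph are
`2 (N - 1) (N - 2)`, so that the four notions above are comparisons with this number. For the graph
without vertices, all energies are empty sums, hence `0`, and it is its own complete graph. -/

open Classical in
theorem cnMatrix_top : cnMatrix (⊤ : SimpleGraph V) =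
    Matrix.of fun i j => if i = j then (0 : ℝ) else (Fintype.card V : ℝ) - 2 := by
  ext i j
  simp only [cnMatrix, Matrix.of_apply]
  split_ifs with h
  · rfl
  · have h2 : ((⊤ : SimpleGraph V).commonNeighbors i j).ncard = Fintype.card V - 2 := by
      rw [← SimpleGraph.card_commonNeighbors_top (V := V) h, Set.ncard_eq_toFinset_card',
        Set.toFinset_card]
    have h3 : 2 ≤ Fintype.card V := Fintype.one_lt_card_iff.mpr ⟨i, j, h⟩
    rw [h2, Nat.cast_sub h3, Nat.cast_ofNat]

open Classical in
theorem cnrsMatrix_top : cnrsMatrix (⊤ : SimpleGraph V) =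
    Matrix.diagonal fun _ => ((Fintype.card V : ℝ) - 1) * ((Fintype.card V : ℝ) - 2) := by
  unfold cnrsMatrix
  congr 1
  funext i
  rw [cnMatrix_top]
  have : ∀ k : V, (if i = k then (0 : ℝ) else (Fintype.card V : ℝ) - 2) =
      ((Fintype.card V : ℝ) - 2) - (if i = k then (Fintype.card V : ℝ) - 2 else 0) := by
    intro k; split_ifs <;> ring
  simp only [Matrix.of_apply, this, Finset.sum_sub_distrib, Finset.sum_ite_eq, Finset.mem_univ,
    if_true, Finset.sum_const, Finset.card_univ, nsmul_eq_mul]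
  ring

open Classical in
theorem cnMean_top [Nonempty V] : cnMean (⊤ : SimpleGraph V) =
    ((Fintype.card V : ℝ) - 1) * ((Fintype.card V : ℝ) - 2) := by
  have h : (Fintype.card V : ℝ) ≠ 0 := by exact_mod_cast Fintype.card_ne_zero
  rw [cnMean, cnrsMatrix_top, Matrix.trace_diagonal, Finset.sum_const, Finset.card_univ,
    nsmul_eq_mul]
  field_simp

open Classical in
theorem spectrumMultiset_const_add_scalar [Nonempty V] (a b : ℝ) :
    spectrumMultiset (Matrix.of fun i j : V => if i = j then a + b else b) =
      Multiset.replicate (Fintype.card V - 1) a + {a + (Fintype.card V : ℝ) * b} := by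
  have hM : (Matrix.of fun i j : V => if i = j then a + b else b) =
      Matrix.vecMulVec (fun _ => b) (fun _ => 1) - Matrix.scalar V (-a) := by
    ext i j
    by_cases h : i = j
    · subst h; simp [Matrix.vecMulVec_apply]; ring
    · simp [Matrix.vecMulVec_apply, h]
  obtain ⟨k, hk⟩ : ∃ k, Fintype.card V = k + 1 :=
    Nat.exists_eq_succ_of_ne_zero Fintype.card_ne_zero
  have hp : (Matrix.of fun i j : V => if i = j then a + b else b).charpoly =
      (Polynomial.X - Polynomial.C a) ^ k *
        (Polynomial.X - Polynomial.C (a + (Fintype.card V : ℝ) * b)) := by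
    rw [hM, Matrix.charpoly_sub_scalar, Matrix.charpoly_vecMulVec]
    simp [hk, dotProduct, Polynomial.smul_eq_C_mul]
    ring
  rw [spectrumMultiset, hp, Polynomial.roots_mul, Polynomial.roots_pow, Polynomial.roots_X_sub_C,
    Polynomial.roots_X_sub_C, hk, Multiset.nsmul_singleton]
  · simp
  · exact mul_ne_zero (pow_ne_zero _ (Polynomial.X_sub_C_ne_zero _)) (Polynomial.X_sub_C_ne_zero _)

open Classical in
theorem cnlMatrix_top : cnlMatrix (⊤ : SimpleGraph V) =
    Matrix.of fun i j : V => if i = j then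
      (Fintype.card V : ℝ) * ((Fintype.card V : ℝ) - 2) + (-((Fintype.card V : ℝ) - 2))
      else -((Fintype.card V : ℝ) - 2) := by
  rw [cnlMatrix, cnrsMatrix_top, cnMatrix_top]
  ext i j
  by_cases h : i = j
  · subst h; simp; ring
  · simp [h]

open Classical in
theorem cnslMatrix_top : cnslMatrix (⊤ : SimpleGraph V) =
    Matrix.of fun i j : V => if i = j then
      ((Fintype.card V : ℝ) - 2) ^ 2 + ((Fintype.card V : ℝ) - 2)
      else (Fintype.card V : ℝ) - 2 := by
  rw [cnslMatrix, cnrsMatrix_top, cnMatrix_top]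
  ext i j
  by_cases h : i = j
  · subst h; simp; ring
  · simp [h]

theorem sub_one_mul_abs_sub_two {n : ℕ} (hn : 0 < n) :
    ((n : ℝ) - 1) * |(n : ℝ) - 2| = ((n : ℝ) - 1) * ((n : ℝ) - 2) := by
  rcases Nat.lt_or_ge n 2 with h | h
  · have : n = 1 := by omega
    subst this; norm_num
  · have : (2 : ℝ) ≤ n := by exact_mod_cast h
    rw [abs_of_nonneg (by linarith)]

/-- The CNL-energy of the complete graph on `N ≥ 1` vertices is `2 (N - 1) (N - 2)`. -/
theorem cnlEnergy_top [Nonempty V] : cnlEnergy (⊤ : SimpleGraph V) =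
    2 * ((Fintype.card V : ℝ) - 1) * ((Fintype.card V : ℝ) - 2) := by
  have h0 : 0 < Fintype.card V := Fintype.card_pos
  have h1 : (1 : ℝ) ≤ Fintype.card V := by exact_mod_cast h0
  rw [cnlEnergy, deviation, cnlMatrix_top, spectrumMultiset_const_add_scalar, cnMean_top]
  simp only [Multiset.map_add, Multiset.map_replicate, Multiset.map_singleton, Multiset.sum_add,
    Multiset.sum_replicate, Multiset.sum_singleton, nsmul_eq_mul, Nat.cast_sub h0, Nat.cast_one]
  have e1 : (Fintype.card V : ℝ) * ((Fintype.card V : ℝ) - 2) -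
      ((Fintype.card V : ℝ) - 1) * ((Fintype.card V : ℝ) - 2) = (Fintype.card V : ℝ) - 2 := by ring
  have e2 : (Fintype.card V : ℝ) * ((Fintype.card V : ℝ) - 2) +
      (Fintype.card V : ℝ) * -((Fintype.card V : ℝ) - 2) -
      ((Fintype.card V : ℝ) - 1) * ((Fintype.card V : ℝ) - 2) =
      -(((Fintype.card V : ℝ) - 1) * ((Fintype.card V : ℝ) - 2)) := by ring
  have e3 := sub_one_mul_abs_sub_two h0
  rw [e1, e2, abs_neg, abs_mul, abs_of_nonneg (by linarith : (0 : ℝ) ≤ (Fintype.card V : ℝ) - 1)]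
  rw [e3]
  ring

/-- The CNSL-energy of the complete graph on `N ≥ 1` vertices is `2 (N - 1) (N - 2)`. -/
theorem cnslEnergy_top [Nonempty V] : cnslEnergy (⊤ : SimpleGraph V) =
    2 * ((Fintype.card V : ℝ) - 1) * ((Fintype.card V : ℝ) - 2) := by
  have h0 : 0 < Fintype.card V := Fintype.card_pos
  have h1 : (1 : ℝ) ≤ Fintype.card V := by exact_mod_cast h0
  rw [cnslEnergy, deviation, cnslMatrix_top, spectrumMultiset_const_add_scalar, cnMean_top]
  simp only [Multiset.map_add, Multiset.map_replicate, Multiset.map_singleton, Multiset.sum_add,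
    Multiset.sum_replicate, Multiset.sum_singleton, nsmul_eq_mul, Nat.cast_sub h0, Nat.cast_one]
  have e1 : ((Fintype.card V : ℝ) - 2) ^ 2 -
      ((Fintype.card V : ℝ) - 1) * ((Fintype.card V : ℝ) - 2) =
      -((Fintype.card V : ℝ) - 2) := by ring
  have e2 : ((Fintype.card V : ℝ) - 2) ^ 2 +
      (Fintype.card V : ℝ) * ((Fintype.card V : ℝ) - 2) -
      ((Fintype.card V : ℝ) - 1) * ((Fintype.card V : ℝ) - 2) =
      ((Fintype.card V : ℝ) - 1) * ((Fintype.card V : ℝ) - 2) := by ring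
  have e3 := sub_one_mul_abs_sub_two h0
  rw [e1, e2, abs_neg, abs_mul, abs_of_nonneg (by linarith : (0 : ℝ) ≤ (Fintype.card V : ℝ) - 1)]
  rw [e3]
  ring

end Graph

section Group

/-- The conjugacy classes of the non-central elements of a group. -/
abbrev Vertex (G : Type*) [Group G] : Type _ :=
  {c : ConjClasses G // ∃ x : G, x ∉ Subgroup.center G ∧ ConjClasses.mk x = c}

noncomputable instance (G : Type*) [Group G] [Finite G] : Fintype (Vertex G) :=
  Fintype.ofFinite _

/-- The commuting conjugacy class graph of a group: two distinct classes of non-central elements are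
adjacent when some element of the one commutes with some element of the other. -/
def cccGraph (G : Type*) [Group G] : SimpleGraph (Vertex G) where
  Adj c d := c ≠ d ∧ ∃ x y : G, ConjClasses.mk x = c.1 ∧ ConjClasses.mk y = d.1 ∧ x * y = y * x
  symm := ⟨fun _ _ ⟨h, x, y, hx, hy, e⟩ => ⟨h.symm, y, x, hy, hx, e.symm⟩⟩
  loopless := ⟨fun _ h => h.1 rfl⟩

/-- The generator `x` of the free group on two generators. -/
def genX : FreeGroup (Fin 2) := FreeGroup.of 0

/-- The generator `y` of the free group on two generators. -/
def genY : FreeGroup (Fin 2) := FreeGroup.of 1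

/-- The group `U_{(n,m)} = ⟨x, y : x ^ (2n) = y ^ m = 1, x⁻¹ y x = y⁻¹⟩`. -/
abbrev GroupU (n m : ℕ) : Type :=
  PresentedGroup ({genX ^ (2 * n), genY ^ m, (genX⁻¹ * genY * genX) * (genY⁻¹)⁻¹} :
    Set (FreeGroup (Fin 2)))

/-- The group `U_{6n} = ⟨x, y : x ^ (2n) = y ^ 3 = 1, x⁻¹ y x = y⁻¹⟩`. -/
abbrev GroupU6 (n : ℕ) : Type :=
  PresentedGroup ({genX ^ (2 * n), genY ^ 3, (genX⁻¹ * genY * genX) * (genY⁻¹)⁻¹} :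
    Set (FreeGroup (Fin 2)))

/-- The semidihedral group `SD_{8n} = ⟨x, y : x ^ (4n) = y ^ 2 = 1, y x y = x ^ (2n - 1)⟩`; here
`n` is positive. -/
abbrev GroupSD (n : ℕ) : Type :=
  PresentedGroup ({genX ^ (4 * n), genY ^ 2, (genY * genX * genY) * (genX ^ (2 * n - 1))⁻¹} :
    Set (FreeGroup (Fin 2)))

/-- A group generated by two elements `a`, `b` of finite order such that conjugation by `a` maps `b`
to a power of `b` is finite. -/
theorem finite_of_generators {G : Type*} [Group G] (a b : G) {N M : ℕ} (hN : 0 < N) (hM : 0 < M)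
    (ha : a ^ N = 1) (hb : b ^ M = 1) (k : ℤ) (hab : a⁻¹ * b * a = b ^ k)
    (hgen : Subgroup.closure {a, b} = ⊤) : Finite G := by
  let S : Set G := {g | ∃ i j : ℤ, g = a ^ i * b ^ j}
  have hfa : (Subgroup.zpowers a : Set G).Finite :=
    (isOfFinOrder_iff_pow_eq_one.mpr ⟨N, hN, ha⟩).finite_zpowers
  have hfb : (Subgroup.zpowers b : Set G).Finite :=
    (isOfFinOrder_iff_pow_eq_one.mpr ⟨M, hM, hb⟩).finite_zpowers
  have hS : S.Finite := by
    refine (Set.Finite.image2 (fun x y => x * y) hfa hfb).subset ?_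
    rintro g ⟨i, j, rfl⟩
    exact ⟨a ^ i, ⟨i, rfl⟩, b ^ j, ⟨j, rfl⟩, rfl⟩
  have hmap : ∀ g ∈ S, g * a ∈ S := by
    rintro g ⟨i, j, rfl⟩
    refine ⟨i + 1, k * j, ?_⟩
    have h : a⁻¹ * b ^ j * a = b ^ (k * j) := by
      rw [zpow_mul, ← hab]
      have := (map_zpow (MulAut.conj a⁻¹) b j)
      simpa [MulAut.conj_apply] using this
    rw [← h, zpow_add, zpow_one]
    group
  have ha' : a⁻¹ = a ^ (N - 1) := by
    rw [inv_eq_iff_mul_eq_one, ← pow_succ', Nat.sub_add_cancel hN, ha]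
  have hpow : ∀ (t : ℕ), ∀ g ∈ S, g * a ^ t ∈ S := by
    intro t
    induction t with
    | zero => intro g hg; simpa using hg
    | succ t ih => intro g hg; rw [pow_succ, ← mul_assoc]; exact hmap _ (ih g hg)
  have hall : ∀ g : G, g ∈ S := by
    intro g
    have hg : g ∈ Subgroup.closure {a, b} := hgen ▸ Subgroup.mem_top g
    induction hg using Subgroup.closure_induction_right with
    | one => exact ⟨0, 0, by simp⟩
    | mul_right x _ y hy hx =>
      rcases hy with rfl | hy
      · exact hmap _ hx
      · obtain ⟨i, j, rfl⟩ := hx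
        rw [Set.mem_singleton_iff.mp hy]
        exact ⟨i, j + 1, by rw [zpow_add, zpow_one, mul_assoc]⟩
    | mul_inv_cancel x _ y hy hx =>
      rcases hy with rfl | hy
      · rw [ha']; exact hpow _ _ hx
      · obtain ⟨i, j, rfl⟩ := hx
        rw [Set.mem_singleton_iff.mp hy]
        exact ⟨i, j - 1, by rw [zpow_sub, zpow_one, mul_assoc]⟩
  exact Set.finite_univ_iff.mp (hS.subset fun g _ => hall g)

theorem closure_generators (rels : Set (FreeGroup (Fin 2))) :
    Subgroup.closure {PresentedGroup.mk rels genX, PresentedGroup.mk rels genY} = ⊤ := by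
  rw [← PresentedGroup.closure_range_of rels]
  congr 1
  ext g
  simp only [Set.mem_insert_iff, Set.mem_singleton_iff, Set.mem_range, Fin.exists_fin_two]
  exact ⟨fun h => h.imp Eq.symm Eq.symm, fun h => h.imp Eq.symm Eq.symm⟩

instance finiteGroupU (n m : ℕ) [NeZero n] [NeZero m] : Finite (GroupU n m) := by
  refine finite_of_generators (N := 2 * n) (M := m) _ _ (by have := NeZero.pos n; omega)
    (NeZero.pos m) ?_ ?_ (-1) ?_ (closure_generators _)
  · rw [← map_pow]; exact PresentedGroup.one_of_mem (by simp)
  · rw [← map_pow]; exact PresentedGroup.one_of_mem (by simp)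
  · rw [zpow_neg, zpow_one, ← map_inv, ← map_inv, ← map_mul, ← map_mul]
    exact PresentedGroup.mk_eq_mk_of_mul_inv_mem (by simp)

instance finiteGroupU6 (n : ℕ) [NeZero n] : Finite (GroupU6 n) :=
  finiteGroupU n 3

instance finiteGroupSD (n : ℕ) [NeZero n] : Finite (GroupSD n) := by
  have hn := NeZero.pos n
  have key : ∀ r : Set (FreeGroup (Fin 2)), genX ^ (4 * n) ∈ r → genY ^ 2 ∈ r →
      (genY * genX * genY) * (genX ^ (2 * n - 1))⁻¹ ∈ r → Finite (PresentedGroup r) := by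
    intro r h1 h2 h3
    have hy : PresentedGroup.mk r genY ^ 2 = 1 := by
      rw [← map_pow]; exact PresentedGroup.one_of_mem h2
    refine finite_of_generators (N := 2) (M := 4 * n) (PresentedGroup.mk r genY)
      (PresentedGroup.mk r genX) (by omega) (by omega) hy ?_ ((2 * n - 1 : ℕ) : ℤ) ?_
      (by rw [Set.pair_comm]; exact closure_generators _)
    · rw [← map_pow]; exact PresentedGroup.one_of_mem h1
    · have h4 : PresentedGroup.mk r genY * PresentedGroup.mk r genY = 1 := by rw [← sq, hy]
      rw [inv_eq_of_mul_eq_one_right h4, zpow_natCast, ← map_pow, ← map_mul, ← map_mul]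
      exact PresentedGroup.mk_eq_mk_of_mul_inv_mem h3
  exact key _ (by simp) (by simp) (by simp)

end Group

end CCC

namespace CCC

/-! ### Common neighbourhood spectra of disjoint unions of complete graphs. -/

section CliqueUnion

open Classical

variable {V ι : Type*} [Fintype V] [Fintype ι]

/-! Every nonabelian group in the five families has an abelian subgroup `A` of index two, and this
alone determines the graph. Write the elements as rotations `rot a` and reflections `ref a`, where
conjugation by `ref 0` acts on `A` as an involution `σ`; let `F` be the kernel and `M` the range of
`σ - 1`. Rotations commute with each other, and the classes of the non-central ones are the pairs
`{a, σ a}`; no non-central rotation commutes with a reflection. Reflections `ref a`, `ref b` are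
conjugate iff `b - a ∈ M` and commute iff `b - a ∈ F`, so their classes lie in the same component
iff `b - a ∈ F + M`. Since `|F| = [A : M] = z`, the graph is a disjoint union of one `K_a` and `k`
copies of `K_b`, with `2a + z = |A|`, `k = [A : F + M]` and `kb = z` (`IndexTwoData.isCliqueUnion`).

On a clique of size `c` the common neighbourhood matrix is `(c - 2)(J - I)`. Hence the CNL
eigenvalues are `c(c - 2)`, with multiplicity `c - 1`, and `0`; the CNSL eigenvalues are `(c - 2)²`,
with multiplicity `c - 1`, and `2(c - 1)(c - 2)`. Multiplied by the number of vertices, both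
energies are explicit in `k`, `a`, `b` (`IsCliqueUnion.energies`). Once it is known which
eigenvalues exceed the mean, the difference from the complete graph is a polynomial, and its sign
gives the classification. The small or equal cliques for which the usual sign pattern fails are
treated separately.

The dihedral and dicyclic groups have this shape by definition. The presented groups are identified
with explicit extensions (`Twist.Extension`) by a normal form argument. The groups `U_{(n,2)}` are
abelian and give the empty graph. -/

omit [Fintype ι] in
theorem natCard_fiber (f : V → ι) (i : ι) :
    Nat.card {v // f v = i} = (Finset.univ.filter fun v => f v = i).card :=
  Nat.subtype_card _ (by simp)

theorem charpoly_eq_prod_fibers (f : V → ι) (hf : Function.Surjective f) (M : Matrix V V ℝ)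
    (hM : ∀ i j, f i ≠ f j → M i j = 0) :
    M.charpoly = ∏ i, (M.toSquareBlock f i).charpoly := by
  -- The blocks off the diagonal vanish on both sides, so any linear order makes `M` block
  -- triangular.
  let : LinearOrder ι := linearOrderOfSTO WellOrderingRel
  have hT : M.BlockTriangular f := fun i j hij => hM i j hij.ne'
  have hchar := hT.charpoly
  rw [Finset.image_univ_of_surjective hf] at hchar
  convert hchar

/-- The spectrum of a block diagonal matrix whose blocks, indexed by the fibres of `f`, are linear
combinations of the identity matrix and the all-ones matrix. -/
theorem deviation_of_blocks (f : V → ι) (hf : Function.Surjective f) (α β : ι → ℝ) (c : ℝ) :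
    deviation (Matrix.of fun i j : V =>
      if f i = f j then (if i = j then α (f i) + β (f i) else β (f i)) else 0) c =
      ∑ i, (((Nat.card {v // f v = i} : ℝ) - 1) * |α i - c| +
        |α i + (Nat.card {v // f v = i} : ℝ) * β i - c|) := by
  set M : Matrix V V ℝ := Matrix.of fun i j : V =>
      if f i = f j then (if i = j then α (f i) + β (f i) else β (f i)) else 0 with hM
  have hne : ∀ i, Nonempty {v // f v = i} := fun i => let ⟨v, hv⟩ := hf i; ⟨⟨v, hv⟩⟩
  have hB : ∀ i, spectrumMultiset (M.toSquareBlock f i) =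
      Multiset.replicate (Nat.card {v // f v = i} - 1) (α i) +
        {α i + (Nat.card {v // f v = i} : ℝ) * β i} := by
    intro i
    have := hne i
    rw [Nat.card_eq_fintype_card, ← spectrumMultiset_const_add_scalar]
    congr 1
    ext ⟨u, rfl⟩ ⟨v, hv⟩
    simp [hM, Matrix.toSquareBlock_def, hv, Subtype.ext_iff]
  have hspec : spectrumMultiset M = ∑ i, spectrumMultiset (M.toSquareBlock f i) := by
    simp only [spectrumMultiset]
    rw [charpoly_eq_prod_fibers f hf M (fun i j hij => by simp [hM, hij]), Polynomial.roots_prod _ _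
      (Finset.prod_ne_zero_iff.mpr fun i _ => (Matrix.charpoly_monic _).ne_zero)]
    refine congrArg Multiset.sum (Multiset.map_congr rfl fun i _ => ?_)
    congr!
  rw [deviation, hspec, ← Multiset.coe_mapAddMonoidHom, map_sum, Multiset.sum_sum]
  refine Finset.sum_congr rfl fun i _ => ?_
  have := hne i
  rw [hB]
  have hpos : 1 ≤ Nat.card {v // f v = i} := Nat.card_pos
  simp [-Nat.card_eq_fintype_card, Nat.cast_sub hpos]


variable {G : SimpleGraph V} {f : V → ι}

omit [Fintype ι] in
/-- The common neighbourhood matrix of a disjoint union of complete graphs. -/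
theorem cnMatrix_of_cliques (hG : ∀ u v, G.Adj u v ↔ u ≠ v ∧ f u = f v) :
    cnMatrix G = Matrix.of fun i j => if f i = f j then
      (if i = j then 0 else (Nat.card {v // f v = f i} : ℝ) - 2) else 0 := by
  ext i j
  simp only [cnMatrix, Matrix.of_apply]
  by_cases hij : i = j
  · simp [hij]
  rw [if_neg hij, if_neg hij]
  split_ifs with h
  · have h1 : G.commonNeighbors i j = ((Finset.univ.filter fun v => f v = f i) \ {i, j} :) := by
      ext v
      simp only [SimpleGraph.mem_commonNeighbors, hG, Finset.coe_sdiff, Set.mem_sdiff,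
        Finset.mem_coe, Finset.mem_filter, Finset.mem_univ, true_and, Finset.mem_insert,
        Finset.mem_singleton, not_or]
      grind
    have h2 : ({i, j} : Finset V) ⊆ Finset.univ.filter fun v => f v = f i := by
      intro v
      simp only [Finset.mem_insert, Finset.mem_singleton, Finset.mem_filter, Finset.mem_univ,
        true_and]
      rintro (rfl | rfl)
      · rfl
      · exact h.symm
    rw [h1, Set.ncard_coe_finset, Finset.card_sdiff_of_subset h2,
      Nat.cast_sub (Finset.card_le_card h2), Finset.card_pair hij, natCard_fiber]
    norm_num
  · have h1 : G.commonNeighbors i j = ∅ := by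
      ext v
      simp only [SimpleGraph.mem_commonNeighbors, hG, Set.mem_empty_iff_false, iff_false]
      grind
    simp [h1]

omit [Fintype ι] in
theorem cnrsMatrix_of_cliques (hG : ∀ u v, G.Adj u v ↔ u ≠ v ∧ f u = f v) :
    cnrsMatrix G = Matrix.diagonal fun i => ((Nat.card {v // f v = f i} : ℝ) - 1) *
      ((Nat.card {v // f v = f i} : ℝ) - 2) := by
  unfold cnrsMatrix
  congr 1
  funext i
  rw [cnMatrix_of_cliques hG]
  have h : ∀ k : V, (if f i = f k then
      (if i = k then 0 else (Nat.card {v // f v = f i} : ℝ) - 2) else 0) =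
      (if f k = f i then (Nat.card {v // f v = f i} : ℝ) - 2 else 0) -
        (if i = k then (Nat.card {v // f v = f i} : ℝ) - 2 else 0) := by
    intro k
    by_cases h : i = k
    · simp [h]
    · simp [h, eq_comm]
  simp only [Matrix.of_apply, h]
  simp only [Finset.sum_sub_distrib, Finset.sum_ite_eq, Finset.mem_univ,
    if_true, ← Finset.sum_filter, Finset.sum_const, nsmul_eq_mul, natCard_fiber]
  ring

theorem card_eq_sum_fibers (f : V → ι) :
    (Fintype.card V : ℝ) = ∑ i, (Nat.card {v // f v = i} : ℝ) := by
  simp only [Nat.card_eq_fintype_card]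
  rw [← Nat.cast_sum, ← Fintype.card_sigma]
  exact congrArg _ (Fintype.card_congr (Equiv.sigmaFiberEquiv f).symm)

theorem cnMean_of_cliques (hG : ∀ u v, G.Adj u v ↔ u ≠ v ∧ f u = f v) :
    cnMean G = (∑ i, (Nat.card {v // f v = i} : ℝ) *
      ((Nat.card {v // f v = i} - 1) * (Nat.card {v // f v = i} - 2))) /
      ∑ i, (Nat.card {v // f v = i} : ℝ) := by
  rw [cnMean, ← card_eq_sum_fibers, cnrsMatrix_of_cliques hG, Matrix.trace_diagonal,
    ← Finset.sum_fiberwise (g := f)]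
  congr 1
  refine Finset.sum_congr rfl fun i _ => ?_
  rw [natCard_fiber, ← nsmul_eq_mul, ← Finset.sum_const]
  refine Finset.sum_congr rfl fun v hv => ?_
  rw [(Finset.mem_filter.mp hv).2, natCard_fiber]

/-- A clique of size `c` contributes the block `c(c - 2) I - (c - 2) J`. The all-ones vector has
eigenvalue `0`, which accounts for the bare `|cnMean G|`. -/
theorem cnlEnergy_of_cliques (hf : Function.Surjective f)
    (hG : ∀ u v, G.Adj u v ↔ u ≠ v ∧ f u = f v) :
    cnlEnergy G = ∑ i, (((Nat.card {v // f v = i} : ℝ) - 1) *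
      |(Nat.card {v // f v = i} : ℝ) * ((Nat.card {v // f v = i} : ℝ) - 2) - cnMean G| +
        |cnMean G|) := by
  have h : cnlMatrix G = Matrix.of fun i j : V => if f i = f j then (if i = j then
      (Nat.card {v // f v = f i} : ℝ) * ((Nat.card {v // f v = f i} : ℝ) - 2) +
        -((Nat.card {v // f v = f i} : ℝ) - 2)
      else -((Nat.card {v // f v = f i} : ℝ) - 2)) else 0 := by
    rw [cnlMatrix, cnrsMatrix_of_cliques hG, cnMatrix_of_cliques hG]
    ext i j
    by_cases hij : i = j
    · subst hij; simp; ring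
    · by_cases hfij : f i = f j <;> simp [hij, hfij]
  rw [cnlEnergy, h, deviation_of_blocks f hf
    (fun i => (Nat.card {v // f v = i} : ℝ) * ((Nat.card {v // f v = i} : ℝ) - 2))
    (fun i => -((Nat.card {v // f v = i} : ℝ) - 2))]
  refine Finset.sum_congr rfl fun i _ => ?_
  congr 1
  rw [← abs_neg (cnMean G)]
  congr 1
  ring

/-- Here the block is `(c - 2)² I + (c - 2) J`, and the all-ones vector has eigenvalue `2(c - 1)(c -
2)`. -/
theorem cnslEnergy_of_cliques (hf : Function.Surjective f)
    (hG : ∀ u v, G.Adj u v ↔ u ≠ v ∧ f u = f v) :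
    cnslEnergy G = ∑ i, (((Nat.card {v // f v = i} : ℝ) - 1) *
      |((Nat.card {v // f v = i} : ℝ) - 2) ^ 2 - cnMean G| +
        |2 * ((Nat.card {v // f v = i} : ℝ) - 1) * ((Nat.card {v // f v = i} : ℝ) - 2) -
          cnMean G|) := by
  have h : cnslMatrix G = Matrix.of fun i j : V => if f i = f j then (if i = j then
      ((Nat.card {v // f v = f i} : ℝ) - 2) ^ 2 +
        ((Nat.card {v // f v = f i} : ℝ) - 2)
      else ((Nat.card {v // f v = f i} : ℝ) - 2)) else 0 := by
    rw [cnslMatrix, cnrsMatrix_of_cliques hG, cnMatrix_of_cliques hG]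
    ext i j
    by_cases hij : i = j
    · subst hij; simp; ring
    · by_cases hfij : f i = f j <;> simp [hij, hfij]
  rw [cnslEnergy, h, deviation_of_blocks f hf
    (fun i => ((Nat.card {v // f v = i} : ℝ) - 2) ^ 2)
    (fun i => ((Nat.card {v // f v = i} : ℝ) - 2))]
  refine Finset.sum_congr rfl fun i _ => ?_
  congr 2
  ring

end CliqueUnion

/-! ### Energies of `K_a` together with `k` copies of `K_b`. -/

section OneAndEqual

/-- The number of vertices of the disjoint union of `K_a` and `k` copies of `K_b`. -/
def cliqueOrder (k : ℕ) (a b : ℝ) : ℝ := a + k * b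

/-- The sum of the diagonal entries of the row sum matrix of the disjoint union of `K_a` and `k`
copies of `K_b`. -/
def cliqueTrace (k : ℕ) (a b : ℝ) : ℝ := a * ((a - 1) * (a - 2)) + k * (b * ((b - 1) * (b - 2)))

/-- The order of the disjoint union of `K_a` and `k` copies of `K_b` times its CNL-energy. -/
def cliqueL (k : ℕ) (a b : ℝ) : ℝ :=
  ((a - 1) * |a * (a - 2) * cliqueOrder k a b - cliqueTrace k a b| + |cliqueTrace k a b|) +
    k * ((b - 1) * |b * (b - 2) * cliqueOrder k a b - cliqueTrace k a b| + |cliqueTrace k a b|)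

/-- The order of the disjoint union of `K_a` and `k` copies of `K_b` times its CNSL-energy. -/
def cliqueS (k : ℕ) (a b : ℝ) : ℝ :=
  ((a - 1) * |(a - 2) ^ 2 * cliqueOrder k a b - cliqueTrace k a b| +
    |2 * (a - 1) * (a - 2) * cliqueOrder k a b - cliqueTrace k a b|) +
    k * ((b - 1) * |(b - 2) ^ 2 * cliqueOrder k a b - cliqueTrace k a b| +
      |2 * (b - 1) * (b - 2) * cliqueOrder k a b - cliqueTrace k a b|)

/-- The order times the energy of the complete graph with as many vertices as the disjoint union of
`K_a` and `k` copies of `K_b`. -/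
def cliqueTop (k : ℕ) (a b : ℝ) : ℝ :=
  cliqueOrder k a b * (2 * (cliqueOrder k a b - 1) * (cliqueOrder k a b - 2))

/-- A graph is the disjoint union of `K_a` and `k` copies of `K_b`. -/
def IsCliqueUnion {V : Type*} [Fintype V] (G : SimpleGraph V) (k a b : ℕ) : Prop :=
  0 < a ∧ 0 < b ∧ ∃ (ι : Type) (_ : Fintype ι) (f : V → Option ι), Nat.card ι = k ∧
    (∀ u v, G.Adj u v ↔ u ≠ v ∧ f u = f v) ∧
    Nat.card {v // f v = none} = a ∧ ∀ i, Nat.card {v // f v = some i} = b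

variable {V : Type*} [Fintype V] {G : SimpleGraph V} {k a b : ℕ}

/-- The mean is `cliqueTrace / cliqueOrder`; multiplying by the positive order clears this
denominator, also inside the absolute values, and keeps comparisons intact. -/
theorem IsCliqueUnion.energies (h : IsCliqueUnion G k a b) :
    0 < cliqueOrder k a b ∧
    cnlEnergy G * cliqueOrder k a b = cliqueL k a b ∧
    cnslEnergy G * cliqueOrder k a b = cliqueS k a b ∧
    cnlEnergy (⊤ : SimpleGraph V) * cliqueOrder k a b = cliqueTop k a b ∧
    cnslEnergy (⊤ : SimpleGraph V) * cliqueOrder k a b = cliqueTop k a b := by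
  classical
  obtain ⟨ha, hb, ι, _, f, hk, hG, hfa, hfb⟩ := h
  have hf : Function.Surjective f := by
    intro o
    have : 0 < Nat.card {v // f v = o} := by
      cases o with
      | none => rwa [hfa]
      | some i => rwa [hfb]
    obtain ⟨⟨v, hv⟩⟩ := (Nat.card_pos_iff.mp this).1
    exact ⟨v, hv⟩
  have hV : Nonempty V := ⟨(hf none).choose⟩
  have hcard : (Fintype.card V : ℝ) = cliqueOrder k a b := by
    rw [card_eq_sum_fibers f, Fintype.sum_option]
    simp [hfa, hfb, ← Nat.card_eq_fintype_card, hk, cliqueOrder]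
  have hpos : 0 < cliqueOrder k a b := by
    rw [← hcard]; exact_mod_cast Fintype.card_pos
  have hmean : cnMean G = cliqueTrace k a b / cliqueOrder k a b := by
    rw [cnMean_of_cliques hG, ← card_eq_sum_fibers, hcard, Fintype.sum_option]
    simp [hfa, hfb, ← Nat.card_eq_fintype_card, hk, cliqueTrace]
  have habs : ∀ t : ℝ, |t - cnMean G| * cliqueOrder k a b =
      |t * cliqueOrder k a b - cliqueTrace k a b| := by
    intro t
    rw [hmean]
    nth_rewrite 2 [← abs_of_pos hpos]
    rw [← abs_mul, sub_mul, div_mul_cancel₀ _ hpos.ne']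
  have habs0 : |cnMean G| * cliqueOrder k a b = |cliqueTrace k a b| := by
    have := habs 0
    simpa using this
  refine ⟨hpos, ?_, ?_, ?_, ?_⟩
  · rw [cnlEnergy_of_cliques hf hG, Fintype.sum_option]
    simp only [hfa, hfb, Finset.sum_const, Finset.card_univ, ← Nat.card_eq_fintype_card, hk, nsmul_eq_mul, cliqueL, ← habs,
      ← habs0]
    ring
  · rw [cnslEnergy_of_cliques hf hG, Fintype.sum_option]
    simp only [hfa, hfb, Finset.sum_const, Finset.card_univ, ← Nat.card_eq_fintype_card, hk, nsmul_eq_mul, cliqueS, ← habs]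
    ring
  · rw [cnlEnergy_top, hcard, cliqueTop]; ring
  · rw [cnslEnergy_top, hcard, cliqueTop]; ring

theorem IsCliqueUnion.isCNLHyperenergetic_iff (h : IsCliqueUnion G k a b) :
    IsCNLHyperenergetic G ↔ cliqueTop k a b < cliqueL k a b := by
  obtain ⟨h0, h1, h2, h3, h4⟩ := h.energies
  rw [← h1, ← h3, mul_lt_mul_iff_left₀ h0]; rfl

theorem IsCliqueUnion.isCNSLHyperenergetic_iff (h : IsCliqueUnion G k a b) :
    IsCNSLHyperenergetic G ↔ cliqueTop k a b < cliqueS k a b := by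
  obtain ⟨h0, h1, h2, h3, h4⟩ := h.energies
  rw [← h2, ← h4, mul_lt_mul_iff_left₀ h0]; rfl

theorem IsCliqueUnion.isCNLBorderenergetic_iff (h : IsCliqueUnion G k a b) :
    IsCNLBorderenergetic G ↔ cliqueL k a b = cliqueTop k a b := by
  obtain ⟨h0, h1, h2, h3, h4⟩ := h.energies
  rw [← h1, ← h3, mul_left_inj' h0.ne']; rfl

theorem IsCliqueUnion.isCNSLBorderenergetic_iff (h : IsCliqueUnion G k a b) :
    IsCNSLBorderenergetic G ↔ cliqueS k a b = cliqueTop k a b := by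
  obtain ⟨h0, h1, h2, h3, h4⟩ := h.energies
  rw [← h2, ← h4, mul_left_inj' h0.ne']; rfl

end OneAndEqual

end CCC

namespace CCC

/-! ### Sign analysis of the energy differences. -/

section Numerics

/-- When the mean is nonnegative and separates the eigenvalue `a(a - 2)` of the large clique from
`b(b - 2)`, every absolute value opens and a polynomial remains. -/
theorem cliqueL_sub_cliqueTop {k : ℕ} {a b : ℝ} (hC : 0 ≤ cliqueTrace k a b)
    (ha : cliqueTrace k a b ≤ a * (a - 2) * cliqueOrder k a b)
    (hb : b * (b - 2) * cliqueOrder k a b ≤ cliqueTrace k a b) :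
    cliqueL k a b - cliqueTop k a b = 2 * ((a - 1) * (a * (a - 2) * (k * b + 1) -
      k * (b * ((b - 1) * (b - 2)))) - (a + k * b) * ((a + k * b - 1) * (a + k * b - 2))) := by
  rw [cliqueL, abs_of_nonneg hC, abs_of_nonneg (sub_nonneg.mpr ha),
    abs_of_nonpos (sub_nonpos.mpr hb), cliqueTop, cliqueOrder, cliqueTrace]
  ring

/-- The sign pattern assumed is that both eigenvalues of the large clique are at least the mean and
both of the small cliques at most the mean. -/
theorem cliqueS_sub_cliqueTop {k : ℕ} {a b : ℝ}
    (ha : cliqueTrace k a b ≤ (a - 2) ^ 2 * cliqueOrder k a b)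
    (ha' : cliqueTrace k a b ≤ 2 * (a - 1) * (a - 2) * cliqueOrder k a b)
    (hb : (b - 2) ^ 2 * cliqueOrder k a b ≤ cliqueTrace k a b)
    (hb' : 2 * (b - 1) * (b - 2) * cliqueOrder k a b ≤ cliqueTrace k a b) :
    cliqueS k a b - cliqueTop k a b = 2 * (a * (k * b * ((a - 1) * (a - 2) - (b - 1) * (b - 2))) -
      (a + k * b) * ((a + k * b - 1) * (a + k * b - 2))) := by
  rw [cliqueS, abs_of_nonneg (sub_nonneg.mpr ha), abs_of_nonneg (sub_nonneg.mpr ha'),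
    abs_of_nonpos (sub_nonpos.mpr hb), abs_of_nonpos (sub_nonpos.mpr hb'), cliqueTop, cliqueOrder,
    cliqueTrace]
  ring

theorem lt_iff_and_ne_of_sub {x y : ℝ} {p : Prop} (h1 : p → 0 < x - y) (h2 : ¬ p → x - y < 0) :
    (y < x ↔ p) ∧ x ≠ y := by
  by_cases hp : p
  · have := h1 hp
    exact ⟨iff_of_true (by linarith) hp, fun h => by linarith⟩
  · have := h2 hp
    exact ⟨iff_of_false (by linarith) hp, fun h => by linarith⟩

/-- The union of a complete graph and an isolated vertex. -/
theorem cliqueL_one_one {a : ℕ} (ha : 1 ≤ a) :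
    (cliqueTop 1 a 1 < cliqueL 1 a 1 ↔ 6 ≤ a) ∧
      (cliqueL 1 a 1 = cliqueTop 1 a 1 ↔ a = 1 ∨ a = 5) := by
  obtain rfl | h : a = 1 ∨ 2 ≤ a := by omega
  · norm_num [cliqueL, cliqueTop, cliqueOrder, cliqueTrace]
  have h' : (2 : ℝ) ≤ a := by exact_mod_cast h
  -- Shifting to the left end of the range turns the sign conditions into polynomials in `u ≥ 0`
  -- without negative coefficients, which `positivity` accepts. The same device recurs below.
  obtain ⟨u, hu⟩ : ∃ u : ℝ, (a : ℝ) = 2 + u := ⟨a - 2, by ring⟩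
  have hu0 : 0 ≤ u := by linarith
  have key : cliqueL 1 a 1 - cliqueTop 1 a 1 = 2 * ((a - 1) * a) * (a - 5) := by
    rw [cliqueL_sub_cliqueTop]
    · push_cast; ring
    all_goals
      rw [← sub_nonneg, hu]
      simp only [cliqueTrace, cliqueOrder]
      push_cast
      ring_nf
      positivity
  have hpos : (0 : ℝ) < 2 * ((a - 1) * a) := by rw [hu]; ring_nf; positivity
  constructor
  · rw [← sub_pos, key, mul_pos_iff_of_pos_left hpos, sub_pos]
    exact_mod_cast Iff.rfl
  · rw [← sub_eq_zero, key, mul_eq_zero, or_iff_right hpos.ne', sub_eq_zero]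
    norm_cast
    omega

theorem cliqueS_one_one {a : ℕ} (ha : 1 ≤ a) :
    ¬ cliqueTop 1 a 1 < cliqueS 1 a 1 ∧ (cliqueS 1 a 1 = cliqueTop 1 a 1 ↔ a = 1) := by
  obtain rfl | h : a = 1 ∨ 2 ≤ a := by omega
  · norm_num [cliqueS, cliqueTop, cliqueOrder, cliqueTrace]
  have h' : (2 : ℝ) ≤ a := by exact_mod_cast h
  have key : cliqueS 1 a 1 - cliqueTop 1 a 1 = - (2 * ((a - 1) * (a + 4))) := by
    obtain ⟨u, hu⟩ : ∃ u : ℝ, (a : ℝ) = 2 + u := ⟨a - 2, by ring⟩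
    have hu0 : 0 ≤ u := by linarith
    simp only [cliqueS, cliqueTop, cliqueOrder, cliqueTrace, hu]
    push_cast
    -- Next to a single isolated vertex, `(a - 2)²` never exceeds the mean, so
    -- `cliqueS_sub_cliqueTop` does not apply. The fourth absolute value has the factor `b - 1 = 0`
    -- and needs no sign.
    rw [abs_of_nonpos, abs_of_nonneg, abs_of_nonpos (a := 2 * (1 - 1) * _ * _ - _)]
    · ring
    all_goals
      first | rw [← neg_nonneg] | skip
      ring_nf
      positivity
  have hneg : cliqueS 1 a 1 - cliqueTop 1 a 1 < 0 := by rw [key]; nlinarith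
  exact ⟨by linarith, iff_of_false (by linarith) (by omega)⟩

/-- The unions of a complete graph with two isolated vertices or with an edge. -/
theorem cliqueL_two {k b a : ℕ} (hkb : k = 2 ∧ b = 1 ∨ k = 1 ∧ b = 2) (ha : 1 ≤ a) :
    (cliqueTop k a b < cliqueL k a b ↔ 6 ≤ a) ∧ cliqueL k a b ≠ cliqueTop k a b := by
  obtain rfl | h : a = 1 ∨ 2 ≤ a := by omega
  · rcases hkb with ⟨rfl, rfl⟩ | ⟨rfl, rfl⟩ <;>
      norm_num [cliqueL, cliqueTop, cliqueOrder, cliqueTrace]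
  have h' : (2 : ℝ) ≤ a := by exact_mod_cast h
  -- Both pairs `(k, b)` satisfy `kb = 2` and `b(b - 1)(b - 2) = 0`, and the difference depends on
  -- `k` and `b` only through these quantities.
  have key : cliqueL k a b - cliqueTop k a b = 2 * a * (2 * a ^ 2 - 12 * a + 4) := by
    obtain ⟨u, hu⟩ : ∃ u : ℝ, (a : ℝ) = 2 + u := ⟨a - 2, by ring⟩
    have hu0 : 0 ≤ u := by linarith
    rw [cliqueL_sub_cliqueTop]
    · rcases hkb with ⟨rfl, rfl⟩ | ⟨rfl, rfl⟩ <;> push_cast <;> ring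
    all_goals
      rw [← sub_nonneg, hu]
      simp only [cliqueTrace, cliqueOrder]
      rcases hkb with ⟨rfl, rfl⟩ | ⟨rfl, rfl⟩ <;>
      · push_cast
        ring_nf
        positivity
  apply lt_iff_and_ne_of_sub <;> intro h6 <;> rw [key]
  · have : (6 : ℝ) ≤ a := by exact_mod_cast h6
    have : (0 : ℝ) < 2 * a ^ 2 - 12 * a + 4 := by nlinarith
    positivity
  · have : (a : ℝ) ≤ 5 := by exact_mod_cast (by omega : a ≤ 5)
    have : 2 * (a : ℝ) ^ 2 - 12 * a + 4 < 0 := by nlinarith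
    exact mul_neg_of_pos_of_neg (by linarith) this

theorem cliqueS_two {k b a : ℕ} (hkb : k = 2 ∧ b = 1 ∨ k = 1 ∧ b = 2) (ha : 1 ≤ a) :
    (cliqueTop k a b < cliqueS k a b ↔ 9 ≤ a) ∧ cliqueS k a b ≠ cliqueTop k a b := by
  -- At `a = 3` the mean still exceeds `(a - 2)²`; from `a = 4` on it does not, and the polynomial
  -- formula holds.
  obtain h | h : a < 4 ∨ 4 ≤ a := by omega
  · interval_cases a <;> rcases hkb with ⟨rfl, rfl⟩ | ⟨rfl, rfl⟩ <;>
      norm_num [cliqueS, cliqueTop, cliqueOrder, cliqueTrace]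
  have h' : (4 : ℝ) ≤ a := by exact_mod_cast h
  have key : cliqueS k a b - cliqueTop k a b = 2 * a * (a ^ 2 - 9 * a + 2) := by
    obtain ⟨u, hu⟩ : ∃ u : ℝ, (a : ℝ) = 4 + u := ⟨a - 4, by ring⟩
    have hu0 : 0 ≤ u := by linarith
    rw [cliqueS_sub_cliqueTop]
    · rcases hkb with ⟨rfl, rfl⟩ | ⟨rfl, rfl⟩ <;> push_cast <;> ring
    all_goals
      rw [← sub_nonneg, hu]
      simp only [cliqueTrace, cliqueOrder]
      rcases hkb with ⟨rfl, rfl⟩ | ⟨rfl, rfl⟩ <;>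
      · push_cast
        ring_nf
        positivity
  apply lt_iff_and_ne_of_sub <;> intro h6 <;> rw [key]
  · have : (9 : ℝ) ≤ a := by exact_mod_cast h6
    have : (0 : ℝ) < a ^ 2 - 9 * a + 2 := by nlinarith
    positivity
  · have : (a : ℝ) ≤ 8 := by exact_mod_cast (by omega : a ≤ 8)
    have : (a : ℝ) ^ 2 - 9 * a + 2 < 0 := by nlinarith
    exact mul_neg_of_pos_of_neg (by linarith) this

/-- The union of a complete graph of even order with `K_4`. -/
theorem cliqueL_four {a : ℕ} (ha : a = 4 ∨ 6 ≤ a) :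
    (cliqueTop 1 a 4 < cliqueL 1 a 4 ↔ 8 ≤ a) ∧ cliqueL 1 a 4 ≠ cliqueTop 1 a 4 := by
  rcases ha with rfl | h
  · norm_num [cliqueL, cliqueTop, cliqueOrder, cliqueTrace]
  have h' : (6 : ℝ) ≤ a := by exact_mod_cast h
  have key : cliqueL 1 a 4 - cliqueTop 1 a 4 = 2 * a * (4 * a ^ 2 - 24 * a - 40) := by
    obtain ⟨u, hu⟩ : ∃ u : ℝ, (a : ℝ) = 6 + u := ⟨a - 6, by ring⟩
    have hu0 : 0 ≤ u := by linarith
    rw [cliqueL_sub_cliqueTop]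
    · push_cast; ring
    all_goals
      rw [← sub_nonneg, hu]
      simp only [cliqueTrace, cliqueOrder]
      push_cast
      ring_nf
      positivity
  apply lt_iff_and_ne_of_sub <;> intro h6 <;> rw [key]
  · have : (8 : ℝ) ≤ a := by exact_mod_cast h6
    have : (0 : ℝ) < 4 * a ^ 2 - 24 * a - 40 := by nlinarith
    positivity
  · have : (a : ℝ) ≤ 7 := by exact_mod_cast (by omega : a ≤ 7)
    have : 4 * (a : ℝ) ^ 2 - 24 * a - 40 < 0 := by nlinarith
    exact mul_neg_of_pos_of_neg (by linarith) this

/-- The value `a = 5` is left out because there the mean exceeds `(a - 2)²`; it is not needed, since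
`a = 2n - 2` is even in the semidihedral case. -/
theorem cliqueS_four {a : ℕ} (ha : a = 4 ∨ 6 ≤ a) :
    (cliqueTop 1 a 4 < cliqueS 1 a 4 ↔ 9 ≤ a) ∧ cliqueS 1 a 4 ≠ cliqueTop 1 a 4 := by
  rcases ha with rfl | h
  · norm_num [cliqueS, cliqueTop, cliqueOrder, cliqueTrace]
  have h' : (6 : ℝ) ≤ a := by exact_mod_cast h
  have key : cliqueS 1 a 4 - cliqueTop 1 a 4 =
      2 * (3 * a ^ 3 - 21 * a ^ 2 - 42 * a - 24) := by
    obtain ⟨u, hu⟩ : ∃ u : ℝ, (a : ℝ) = 6 + u := ⟨a - 6, by ring⟩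
    have hu0 : 0 ≤ u := by linarith
    rw [cliqueS_sub_cliqueTop]
    · push_cast; ring
    all_goals
      rw [← sub_nonneg, hu]
      simp only [cliqueTrace, cliqueOrder]
      push_cast
      ring_nf
      positivity
  apply lt_iff_and_ne_of_sub <;> intro h6 <;> rw [key]
  · obtain ⟨u, rfl⟩ := Nat.exists_eq_add_of_le h6
    push_cast
    ring_nf
    positivity
  · have h8 : a ≤ 8 := by omega
    interval_cases a <;> norm_num

/-- The union of equal complete graphs. -/
theorem cliqueL_equal {k n : ℕ} (hk : k = 1 ∨ k = 2) (hn : 2 ≤ n) :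
    cliqueL k n n < cliqueTop k n n := by
  obtain ⟨u, rfl⟩ := Nat.exists_eq_add_of_le hn
  rw [← sub_pos]
  -- With equal cliques the mean is `(n - 1)(n - 2)`, at most `n(n - 2)` for all of them, so no
  -- clique lies on the lower side and the general formula is unavailable.
  simp only [cliqueL, cliqueTop, cliqueOrder, cliqueTrace]
  rcases hk with rfl | rfl <;> push_cast <;> rw [abs_of_nonneg, abs_of_nonneg] <;>
  · ring_nf
    positivity

/-- The mean `(n - 1)(n - 2)` lies between the two eigenvalues `(n - 2)²` and `2(n - 1)(n - 2)` of
each clique, so the absolute values open with opposite signs. -/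
theorem cliqueS_equal {k n : ℕ} (hk : k = 1 ∨ k = 2) (hn : 2 ≤ n) :
    cliqueS k n n < cliqueTop k n n := by
  obtain ⟨u, rfl⟩ := Nat.exists_eq_add_of_le hn
  rw [← sub_pos]
  simp only [cliqueS, cliqueTop, cliqueOrder, cliqueTrace]
  rcases hk with rfl | rfl <;> push_cast <;> rw [abs_of_nonpos, abs_of_nonneg]
  any_goals ring_nf; positivity
  all_goals
    rw [← neg_nonneg]
    ring_nf
    positivity

/-- These are the shapes arising from `U_{(n,m)}`, where the large clique is `q` times as large as
the others. With `q > k` and `n ≥ 2` the mean separates the two sizes, and a factor `2n` splits off.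
-/
theorem cliqueL_mul_sub_cliqueTop {k q n : ℕ} (hk : k = 1 ∨ k = 2) (hq : k + 1 ≤ q) (hn : 2 ≤ n) :
    cliqueL k (n * q : ℕ) n - cliqueTop k (n * q : ℕ) n =
      2 * n * ((q * n - 1) * (q * (q * n - 2) * (k * n + 1) - k * ((n - 1) * (n - 2))) -
        (q + k) * ((n * q + k * n - 1) * (n * q + k * n - 2))) := by
  obtain ⟨v, rfl⟩ := Nat.exists_eq_add_of_le hn
  obtain ⟨u, rfl⟩ := Nat.exists_eq_add_of_le hq
  rw [cliqueL_sub_cliqueTop]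
  · push_cast; ring
  all_goals
    rw [← sub_nonneg]
    simp only [cliqueTrace, cliqueOrder]
    rcases hk with rfl | rfl <;>
    · push_cast
      ring_nf
      positivity

theorem cliqueS_mul_sub_cliqueTop {k q n : ℕ} (hk : k = 1 ∨ k = 2) (hq : k + 1 ≤ q) (hn : 2 ≤ n) :
    cliqueS k (n * q : ℕ) n - cliqueTop k (n * q : ℕ) n =
      2 * n * (q * (k * n * ((q * n - 1) * (q * n - 2) - (n - 1) * (n - 2))) -
        (q + k) * ((n * q + k * n - 1) * (n * q + k * n - 2))) := by
  obtain ⟨v, rfl⟩ := Nat.exists_eq_add_of_le hn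
  obtain ⟨u, rfl⟩ := Nat.exists_eq_add_of_le hq
  rw [cliqueS_sub_cliqueTop]
  · push_cast; ring
  all_goals
    rw [← sub_nonneg]
    simp only [cliqueTrace, cliqueOrder]
    rcases hk with rfl | rfl <;>
    · push_cast
      ring_nf
      positivity

end Numerics
end CCC

namespace CCC

/-! ### Exceptional parameters when the large clique is a multiple of the small ones. -/

section Numerics

theorem cliqueL_one_mul {q n : ℕ} (hq : 1 ≤ q) (hn : 2 ≤ n) :
    (cliqueTop 1 (n * q : ℕ) n < cliqueL 1 (n * q : ℕ) n ↔ ¬ (q = 1 ∨ q = 2 ∧ n ≤ 3)) ∧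
      cliqueL 1 (n * q : ℕ) n ≠ cliqueTop 1 (n * q : ℕ) n := by
  obtain rfl | hq2 : q = 1 ∨ 2 ≤ q := by omega
  · have := cliqueL_equal (k := 1) (Or.inl rfl) hn
    rw [mul_one]
    exact ⟨iff_of_false this.le.not_gt (by simp), this.ne⟩
  have key := cliqueL_mul_sub_cliqueTop (k := 1) (Or.inl rfl) hq2 hn
  apply lt_iff_and_ne_of_sub <;> intro h <;> rw [key]
  -- The non-exceptional pairs are covered by regions with a lowest corner; expanded there, the
  -- difference has no negative coefficients. The three lemmas below use the same kind of cover.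
  · obtain ⟨hq4, hn2⟩ | ⟨rfl, hn4⟩ : (3 ≤ q ∧ 2 ≤ n) ∨ (q = 2 ∧ 4 ≤ n) := by omega
    · obtain ⟨u, rfl⟩ := Nat.exists_eq_add_of_le hq4
      obtain ⟨v, rfl⟩ := Nat.exists_eq_add_of_le hn2
      push_cast
      ring_nf
      positivity
    · obtain ⟨v, rfl⟩ := Nat.exists_eq_add_of_le hn4
      push_cast
      ring_nf
      positivity
  · obtain ⟨rfl, rfl | rfl⟩ : q = 2 ∧ (n = 2 ∨ n = 3) := by omega
    all_goals norm_num

theorem cliqueS_one_mul {q n : ℕ} (hq : 1 ≤ q) (hn : 2 ≤ n) :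
    (cliqueTop 1 (n * q : ℕ) n < cliqueS 1 (n * q : ℕ) n ↔
      ¬ (q = 1 ∨ q = 2 ∧ n ≤ 4 ∨ (q = 3 ∨ q = 4) ∧ n = 2)) ∧
      cliqueS 1 (n * q : ℕ) n ≠ cliqueTop 1 (n * q : ℕ) n := by
  obtain rfl | hq2 : q = 1 ∨ 2 ≤ q := by omega
  · have := cliqueS_equal (k := 1) (Or.inl rfl) hn
    rw [mul_one]
    exact ⟨iff_of_false this.le.not_gt (by simp), this.ne⟩
  have key := cliqueS_mul_sub_cliqueTop (k := 1) (Or.inl rfl) hq2 hn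
  apply lt_iff_and_ne_of_sub <;> intro h <;> rw [key]
  · obtain ⟨hq4, hn2⟩ | ⟨hq3, hn3⟩ | ⟨rfl, hn4⟩ :
        (5 ≤ q ∧ 2 ≤ n) ∨ (3 ≤ q ∧ 3 ≤ n) ∨ (q = 2 ∧ 5 ≤ n) := by omega
    · obtain ⟨u, rfl⟩ := Nat.exists_eq_add_of_le hq4
      obtain ⟨v, rfl⟩ := Nat.exists_eq_add_of_le hn2
      push_cast
      ring_nf
      positivity
    · obtain ⟨u, rfl⟩ := Nat.exists_eq_add_of_le hq3
      obtain ⟨v, rfl⟩ := Nat.exists_eq_add_of_le hn3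
      push_cast
      ring_nf
      positivity
    · obtain ⟨v, rfl⟩ := Nat.exists_eq_add_of_le hn4
      push_cast
      ring_nf
      positivity
  · obtain ⟨rfl, rfl | rfl | rfl⟩ | ⟨rfl | rfl, rfl⟩ :
        q = 2 ∧ (n = 2 ∨ n = 3 ∨ n = 4) ∨ (q = 3 ∨ q = 4) ∧ n = 2 := by omega
    all_goals norm_num

theorem cliqueL_two_mul {q n : ℕ} (hq : q = 1 ∨ 3 ≤ q) (hn : 2 ≤ n) :
    (cliqueTop 2 (n * q : ℕ) n < cliqueL 2 (n * q : ℕ) n ↔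
      ¬ (q = 1 ∨ q = 3 ∧ n = 2)) ∧
      cliqueL 2 (n * q : ℕ) n ≠ cliqueTop 2 (n * q : ℕ) n := by
  obtain rfl | hq2 := hq
  · have := cliqueL_equal (k := 2) (Or.inr rfl) hn
    rw [mul_one]
    exact ⟨iff_of_false this.le.not_gt (by simp), this.ne⟩
  have key := cliqueL_mul_sub_cliqueTop (k := 2) (Or.inr rfl) hq2 hn
  apply lt_iff_and_ne_of_sub <;> intro h <;> rw [key]
  · obtain ⟨hq4, hn2⟩ | ⟨hq3, hn3⟩ : (4 ≤ q ∧ 2 ≤ n) ∨ (3 ≤ q ∧ 3 ≤ n) := by omega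
    · obtain ⟨u, rfl⟩ := Nat.exists_eq_add_of_le hq4
      obtain ⟨v, rfl⟩ := Nat.exists_eq_add_of_le hn2
      push_cast
      ring_nf
      positivity
    · obtain ⟨u, rfl⟩ := Nat.exists_eq_add_of_le hq3
      obtain ⟨v, rfl⟩ := Nat.exists_eq_add_of_le hn3
      push_cast
      ring_nf
      positivity
  · obtain ⟨rfl, rfl⟩ : q = 3 ∧ n = 2 := by omega
    norm_num

theorem cliqueS_two_mul {q n : ℕ} (hq : q = 1 ∨ 3 ≤ q) (hn : 2 ≤ n) :
    (cliqueTop 2 (n * q : ℕ) n < cliqueS 2 (n * q : ℕ) n ↔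
      ¬ (q = 1 ∨ q = 3 ∧ n = 2)) ∧
      cliqueS 2 (n * q : ℕ) n ≠ cliqueTop 2 (n * q : ℕ) n := by
  obtain rfl | hq2 := hq
  · have := cliqueS_equal (k := 2) (Or.inr rfl) hn
    rw [mul_one]
    exact ⟨iff_of_false this.le.not_gt (by simp), this.ne⟩
  have key := cliqueS_mul_sub_cliqueTop (k := 2) (Or.inr rfl) hq2 hn
  apply lt_iff_and_ne_of_sub <;> intro h <;> rw [key]
  · obtain ⟨hq4, hn2⟩ | ⟨hq3, hn3⟩ : (4 ≤ q ∧ 2 ≤ n) ∨ (3 ≤ q ∧ 3 ≤ n) := by omega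
    · obtain ⟨u, rfl⟩ := Nat.exists_eq_add_of_le hq4
      obtain ⟨v, rfl⟩ := Nat.exists_eq_add_of_le hn2
      push_cast
      ring_nf
      positivity
    · obtain ⟨u, rfl⟩ := Nat.exists_eq_add_of_le hq3
      obtain ⟨v, rfl⟩ := Nat.exists_eq_add_of_le hn3
      push_cast
      ring_nf
      positivity
  · obtain ⟨rfl, rfl⟩ : q = 3 ∧ n = 2 := by omega
    norm_num

end Numerics
end CCC

namespace CCC

/-! ### The graph of a group with an abelian subgroup of index two. -/

section IndexTwo

/-- A presentation of a group `G` by an abelian subgroup `A` of index two (with elements `rot a`)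
and its other coset (with elements `ref a`, where `ref a = ref 0 * rot a`); conjugation by `ref 0`
acts on `A` as `σ`. -/
structure IndexTwoData (A G : Type) [AddCommGroup A] [Group G] where
  rot : A → G
  ref : A → G
  σ : A →+ A
  c : A
  rot_mul_rot : ∀ a b, rot a * rot b = rot (a + b)
  rot_mul_ref : ∀ a b, rot a * ref b = ref (σ a + b)
  ref_mul_rot : ∀ a b, ref a * rot b = ref (a + b)
  ref_mul_ref : ∀ a b, ref a * ref b = rot (c + σ a + b)
  bijective : Function.Bijective (Sum.elim rot ref)

theorem isConj_iff_exists_mul_eq {G : Type*} [Group G] {x y : G} :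
    IsConj x y ↔ ∃ g : G, g * x = y * g := by
  simp only [isConj_iff, mul_inv_eq_iff_eq_mul]

namespace IndexTwoData

variable {A G : Type} [AddCommGroup A] [Group G] (D : IndexTwoData A G)

theorem rot_inj {a b : A} : D.rot a = D.rot b ↔ a = b :=
  ⟨fun h => Sum.inl_injective (D.bijective.1 (a₁ := .inl a) (a₂ := .inl b) h), fun h => h ▸ rfl⟩

theorem ref_inj {a b : A} : D.ref a = D.ref b ↔ a = b :=
  ⟨fun h => Sum.inr_injective (D.bijective.1 (a₁ := .inr a) (a₂ := .inr b) h), fun h => h ▸ rfl⟩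

theorem rot_ne_ref (a b : A) : D.rot a ≠ D.ref b := fun h => by
  simpa using D.bijective.1 (a₁ := .inl a) (a₂ := .inr b) h

theorem cases (x : G) : (∃ a, x = D.rot a) ∨ ∃ a, x = D.ref a := by
  obtain ⟨a | a, rfl⟩ := D.bijective.2 x
  · exact Or.inl ⟨a, rfl⟩
  · exact Or.inr ⟨a, rfl⟩

/-- The square of `ref 0` is the rotation `rot c`, which commutes with `A`; associativity of `rot a
* ref 0 * ref 0` expresses this. -/
theorem σ_σ (a : A) : D.σ (D.σ a) = a := by
  have h := mul_assoc (D.rot a) (D.ref 0) (D.ref 0)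
  simp only [D.rot_mul_ref, D.ref_mul_ref, D.rot_mul_rot, D.rot_inj, map_zero, add_zero] at h
  rw [add_comm a] at h
  exact add_left_cancel h

/-- The fixed points of `σ`. -/
def fixed : AddSubgroup A := (D.σ - AddMonoidHom.id A).ker

/-- The elements `σ a - a`. -/
def moved : AddSubgroup A := (D.σ - AddMonoidHom.id A).range

theorem mem_fixed {a : A} : a ∈ D.fixed ↔ D.σ a = a := by
  simp [fixed, AddMonoidHom.mem_ker, sub_eq_zero]

theorem mem_moved {a : A} : a ∈ D.moved ↔ ∃ d, D.σ d - d = a := by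
  simp [moved, AddMonoidHom.mem_range]

/-- The kernel and range of the same endomorphism `σ - 1` of a finite group: the order of the one is
the index of the other. -/
theorem card_fixed [Finite A] : Nat.card D.fixed = D.moved.index := by
  have h1 := D.moved.card_mul_index
  have h2 := D.fixed.card_mul_index
  have h3 : D.fixed.index = Nat.card D.moved := AddSubgroup.index_ker _
  rw [h3, mul_comm, ← h1] at h2
  exact Nat.eq_of_mul_eq_mul_left Nat.card_pos h2

theorem isConj_rot_rot {a b : A} : IsConj (D.rot a) (D.rot b) ↔ b = a ∨ b = D.σ a := by
  rw [isConj_iff_exists_mul_eq]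
  constructor
  · rintro ⟨g, hg⟩
    obtain ⟨d, rfl⟩ | ⟨d, rfl⟩ := D.cases g
    · rw [D.rot_mul_rot, D.rot_mul_rot, D.rot_inj, add_comm] at hg
      exact Or.inl (add_right_cancel hg).symm
    · rw [D.ref_mul_rot, D.rot_mul_ref, D.ref_inj, add_comm] at hg
      rw [add_right_cancel hg, D.σ_σ]
      exact Or.inr rfl
  · rintro (rfl | rfl)
    · exact ⟨1, by simp⟩
    · exact ⟨D.ref 0, by rw [D.ref_mul_rot, D.rot_mul_ref, D.σ_σ, add_comm]⟩

theorem not_isConj_rot_ref (a b : A) : ¬ IsConj (D.rot a) (D.ref b) := by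
  rw [isConj_iff_exists_mul_eq]
  rintro ⟨g, hg⟩
  obtain ⟨d, rfl⟩ | ⟨d, rfl⟩ := D.cases g
  · rw [D.rot_mul_rot, D.ref_mul_rot] at hg
    exact D.rot_ne_ref _ _ hg
  · rw [D.ref_mul_rot, D.ref_mul_ref] at hg
    exact D.rot_ne_ref _ _ hg.symm

theorem isConj_ref_ref {a b : A} : IsConj (D.ref a) (D.ref b) ↔ -a + b ∈ D.moved := by
  rw [isConj_iff_exists_mul_eq, D.mem_moved]
  constructor
  · rintro ⟨g, hg⟩
    obtain ⟨d, rfl⟩ | ⟨d, rfl⟩ := D.cases g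
    · rw [D.rot_mul_ref, D.ref_mul_rot, D.ref_inj] at hg
      refine ⟨d, ?_⟩
      rw [sub_eq_iff_eq_add, add_assoc, ← hg]
      abel
    · rw [D.ref_mul_ref, D.ref_mul_ref, D.rot_inj] at hg
      -- Since `ref d = rot (σ (d - a)) * ref a` and `ref a` centralises itself, conjugating by `ref
      -- d` amounts to conjugating by the rotation of `e = σ (d - a)`, and `σ e - e = σ (a - d) - (a
      -- - d)`.
      refine ⟨a - d, ?_⟩
      have h := congrArg D.σ (show D.σ d + a = D.σ b + d by
        simpa only [add_assoc, add_right_inj] using hg)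
      simp only [map_add, D.σ_σ] at h
      rw [map_sub, show b = d + D.σ a - D.σ d by rw [h]; abel]
      abel
  · rintro ⟨d, hd⟩
    refine ⟨D.rot d, ?_⟩
    rw [D.rot_mul_ref, D.ref_mul_rot, D.ref_inj, show b = a + (-a + b) by abel, ← hd]
    abel

theorem rot_comm (a b : A) : D.rot a * D.rot b = D.rot b * D.rot a := by
  rw [D.rot_mul_rot, D.rot_mul_rot, add_comm]

theorem rot_comm_ref_iff {a b : A} :
    D.rot a * D.ref b = D.ref b * D.rot a ↔ D.σ a = a := by
  rw [D.rot_mul_ref, D.ref_mul_rot, D.ref_inj, add_comm, add_right_inj]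

theorem ref_comm_ref_iff {a b : A} :
    D.ref a * D.ref b = D.ref b * D.ref a ↔ -a + b ∈ D.fixed := by
  rw [D.ref_mul_ref, D.ref_mul_ref, D.rot_inj, add_assoc, add_assoc, add_right_inj, D.mem_fixed,
    map_add, map_neg, ← sub_eq_zero, ← neg_eq_zero, ← sub_eq_zero (a := -D.σ a + D.σ b)]
  exact iff_of_eq (by congr 1; abel)

theorem rot_mem_center_iff {a : A} : D.rot a ∈ Subgroup.center G ↔ D.σ a = a := by
  rw [Subgroup.mem_center_iff]
  constructor
  · intro h
    exact (D.rot_comm_ref_iff (b := 0)).mp (h _).symm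
  · intro h g
    obtain ⟨d, rfl⟩ | ⟨d, rfl⟩ := D.cases g
    · exact D.rot_comm _ _
    · exact (D.rot_comm_ref_iff.mpr h).symm

theorem ref_notMem_center (hσ : ∃ a, D.σ a ≠ a) (a : A) : D.ref a ∉ Subgroup.center G := by
  obtain ⟨b, hb⟩ := hσ
  intro h
  exact hb (D.rot_comm_ref_iff.mp (Subgroup.mem_center_iff.mp h _))

/-- The conjugacy class of a rotation. -/
def rotVertex (a : {a // D.σ a ≠ a}) : Vertex G :=
  ⟨ConjClasses.mk (D.rot a), D.rot a, fun h => a.2 (D.rot_mem_center_iff.mp h), rfl⟩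

/-- The conjugacy class of a reflection. -/
def refVertex (hσ : ∃ a, D.σ a ≠ a) (a : A) : Vertex G :=
  ⟨ConjClasses.mk (D.ref a), D.ref a, D.ref_notMem_center hσ a, rfl⟩

variable (hσ : ∃ a, D.σ a ≠ a)

theorem vertex_cases (v : Vertex G) :
    (∃ a, v = D.rotVertex a) ∨ ∃ a, v = D.refVertex hσ a := by
  obtain ⟨_, x, hx, rfl⟩ := v
  obtain ⟨d, rfl⟩ | ⟨d, rfl⟩ := D.cases x
  · exact Or.inl ⟨⟨d, fun h => hx (D.rot_mem_center_iff.mpr h)⟩, rfl⟩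
  · exact Or.inr ⟨d, rfl⟩

theorem rotVertex_eq_iff {a b : {a // D.σ a ≠ a}} :
    D.rotVertex a = D.rotVertex b ↔ (b : A) = a ∨ (b : A) = D.σ a := by
  rw [rotVertex, rotVertex, Subtype.mk.injEq, ConjClasses.mk_eq_mk_iff_isConj, D.isConj_rot_rot]

theorem refVertex_eq_iff {a b : A} :
    D.refVertex hσ a = D.refVertex hσ b ↔ -a + b ∈ D.moved := by
  rw [refVertex, refVertex, Subtype.mk.injEq, ConjClasses.mk_eq_mk_iff_isConj, D.isConj_ref_ref]

theorem rotVertex_ne_refVertex (a : {a // D.σ a ≠ a}) (b : A) :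
    D.rotVertex a ≠ D.refVertex hσ b := by
  rw [rotVertex, refVertex, Ne, Subtype.mk.injEq, ConjClasses.mk_eq_mk_iff_isConj]
  exact D.not_isConj_rot_ref _ _

theorem adj_rotVertex {a b : {a // D.σ a ≠ a}} :
    (cccGraph G).Adj (D.rotVertex a) (D.rotVertex b) ↔ D.rotVertex a ≠ D.rotVertex b :=
  ⟨fun h => h.1, fun h => ⟨h, _, _, rfl, rfl, D.rot_comm a b⟩⟩

/-- A rotation commuting with some reflection is fixed by `σ`, hence central, and so is each of its
conjugates. -/
theorem not_adj_rotVertex_refVertex (a : {a // D.σ a ≠ a}) (b : A) :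
    ¬ (cccGraph G).Adj (D.rotVertex a) (D.refVertex hσ b) := by
  rintro ⟨-, x, y, hx, hy, hxy⟩
  replace hx := (ConjClasses.mk_eq_mk_iff_isConj.mp hx).symm
  replace hy := (ConjClasses.mk_eq_mk_iff_isConj.mp hy)
  obtain ⟨d, rfl⟩ | ⟨d, rfl⟩ := D.cases x
  · obtain ⟨e, rfl⟩ | ⟨e, rfl⟩ := D.cases y
    · exact D.not_isConj_rot_ref _ _ hy
    · rw [D.rot_comm_ref_iff] at hxy
      obtain rfl | rfl := D.isConj_rot_rot.mp hx
      · exact a.2 hxy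
      · exact a.2 (by rw [D.σ_σ] at hxy; exact hxy.symm)
  · exact D.not_isConj_rot_ref _ _ hx

/-- Replacing either reflection by a conjugate shifts its parameter by an element of `moved`;
commuting of the representatives requires a difference in `fixed`. -/
theorem adj_refVertex {a b : A} :
    (cccGraph G).Adj (D.refVertex hσ a) (D.refVertex hσ b) ↔
      D.refVertex hσ a ≠ D.refVertex hσ b ∧ -a + b ∈ D.fixed ⊔ D.moved := by
  refine and_congr_right fun _ => ?_
  constructor
  · rintro ⟨x, y, hx, hy, hxy⟩
    replace hx := (ConjClasses.mk_eq_mk_iff_isConj.mp hx).symm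
    replace hy := (ConjClasses.mk_eq_mk_iff_isConj.mp hy)
    obtain ⟨d, rfl⟩ | ⟨d, rfl⟩ := D.cases x
    · exact (D.not_isConj_rot_ref _ _ hx.symm).elim
    obtain ⟨e, rfl⟩ | ⟨e, rfl⟩ := D.cases y
    · exact (D.not_isConj_rot_ref _ _ hy).elim
    rw [D.isConj_ref_ref] at hx hy
    rw [D.ref_comm_ref_iff] at hxy
    have h := add_mem (add_mem (AddSubgroup.mem_sup_right (S := D.fixed) hx)
      (AddSubgroup.mem_sup_left (T := D.moved) hxy)) (AddSubgroup.mem_sup_right hy)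
    convert h using 1
    abel
  · intro h
    obtain ⟨z, hz, w, hw, hzw⟩ := AddSubgroup.mem_sup.mp h
    refine ⟨D.ref a, D.ref (a + z), rfl, ?_, ?_⟩
    · rw [refVertex, ConjClasses.mk_eq_mk_iff_isConj, D.isConj_ref_ref]
      convert hw using 1
      rw [show b = a + (-a + b) by abel, ← hzw]
      abel
    · rw [D.ref_comm_ref_iff]
      simpa using hz

/-- The connected component of a vertex. -/
noncomputable def component (v : Vertex G) : Option (A ⧸ (D.fixed ⊔ D.moved)) :=
  open Classical in
  if h : ∃ a, v = D.refVertex hσ a then some (QuotientAddGroup.mk h.choose) else none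

theorem component_rotVertex (a : {a // D.σ a ≠ a}) : D.component hσ (D.rotVertex a) = none :=
  dif_neg fun ⟨_, hb⟩ => D.rotVertex_ne_refVertex hσ _ _ hb

theorem component_refVertex (a : A) :
    D.component hσ (D.refVertex hσ a) = some (QuotientAddGroup.mk a) := by
  have h : ∃ b, D.refVertex hσ a = D.refVertex hσ b := ⟨a, rfl⟩
  rw [component, dif_pos h, Option.some_inj, eq_comm, QuotientAddGroup.eq]
  -- The chosen representative may differ from `a`, but only by an element of `moved`, which the
  -- quotient kills.
  exact AddSubgroup.mem_sup_right ((D.refVertex_eq_iff hσ).mp h.choose_spec)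

theorem adj_iff (u v : Vertex G) :
    (cccGraph G).Adj u v ↔ u ≠ v ∧ D.component hσ u = D.component hσ v := by
  obtain ⟨a, rfl⟩ | ⟨a, rfl⟩ := D.vertex_cases hσ u <;>
    obtain ⟨b, rfl⟩ | ⟨b, rfl⟩ := D.vertex_cases hσ v
  · simp [D.adj_rotVertex, component_rotVertex]
  · simp [D.not_adj_rotVertex_refVertex, component_rotVertex, component_refVertex]
  · rw [SimpleGraph.adj_comm]
    simp [D.not_adj_rotVertex_refVertex, component_rotVertex, component_refVertex]
  · rw [D.adj_refVertex, component_refVertex, component_refVertex, Option.some_inj,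
      QuotientAddGroup.eq]

theorem card_eq_card_mul_of_fibers {X Y : Type*} [Finite X] [Finite Y] (g : X → Y) (k : ℕ)
    (h : ∀ y, Nat.card {x // g x = y} = k) : Nat.card X = Nat.card Y * k := by
  have := Fintype.ofFinite Y
  rw [Nat.card_congr (Equiv.sigmaFiberEquiv g).symm, Nat.card_sigma]
  simp [h]

theorem card_coset (H : AddSubgroup A) (a : A) : Nat.card {x // -a + x ∈ H} = Nat.card H :=
  Nat.card_congr ((Equiv.addLeft (-a)).subtypeEquiv fun _ => Iff.rfl)

/-- Passing from non-fixed elements of `A` to classes is two-to-one, with fibres `{a, σ a}`, and the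
fixed elements number `D.moved.index`. -/
theorem two_mul_card_rotVertex [Finite A] [Finite G] :
    2 * Nat.card {v // D.component hσ v = none} + D.moved.index = Nat.card A := by
  classical
  have h1 : Nat.card {a // D.σ a ≠ a} = Nat.card {v // D.component hσ v = none} * 2 := by
    refine card_eq_card_mul_of_fibers
      (fun a => ⟨D.rotVertex a, D.component_rotVertex hσ a⟩) 2 ?_
    rintro ⟨v, hv⟩
    obtain ⟨a, rfl⟩ | ⟨a, rfl⟩ := D.vertex_cases hσ v
    · have hσa : D.σ (D.σ a) ≠ D.σ a := by rw [D.σ_σ]; exact a.2.symm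
      rw [Nat.card_eq_two_iff]
      refine ⟨⟨a, rfl⟩, ⟨⟨D.σ a, hσa⟩, ?_⟩, ?_, ?_⟩
      · rw [Subtype.mk.injEq, D.rotVertex_eq_iff]
        exact Or.inr (D.σ_σ _).symm
      · intro h
        exact a.2 (congrArg (fun x => (x.1.1 : A)) h).symm
      · rw [Set.eq_univ_iff_forall]
        rintro ⟨b, hb⟩
        rw [Subtype.mk.injEq, eq_comm, D.rotVertex_eq_iff] at hb
        simpa [Subtype.ext_iff] using hb
    · rw [component_refVertex] at hv
      cases hv
  have h2 : Nat.card A = Nat.card {a // D.σ a = a} + Nat.card {a // D.σ a ≠ a} := by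
    rw [← Nat.card_sum]
    exact Nat.card_congr (Equiv.sumCompl fun a => D.σ a = a).symm
  have h3 : Nat.card {a // D.σ a = a} = D.moved.index := by
    rw [← card_fixed]
    exact Nat.card_congr (Equiv.subtypeEquivRight fun a => D.mem_fixed.symm)
  omega

/-- A coset of `fixed ⊔ moved` maps onto the reflection classes of its component, with the cosets of
`moved` as fibres; so all these components have the same size. -/
theorem card_mul_card_refVertex [Finite A] [Finite G] (q : A ⧸ (D.fixed ⊔ D.moved)) :
    (D.fixed ⊔ D.moved).index * Nat.card {v // D.component hσ v = some q} = D.moved.index := by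
  obtain ⟨a, rfl⟩ := QuotientAddGroup.mk_surjective q
  have h1 : Nat.card {x // -a + x ∈ D.fixed ⊔ D.moved} =
      Nat.card {v // D.component hσ v = some (QuotientAddGroup.mk a)} * Nat.card D.moved := by
    refine card_eq_card_mul_of_fibers (fun x => ⟨D.refVertex hσ x, ?_⟩) _ ?_
    rotate_left
    · rw [component_refVertex, Option.some_inj, eq_comm, QuotientAddGroup.eq]
      exact x.2
    · rintro ⟨v, hv⟩
      obtain ⟨b, rfl⟩ | ⟨b, rfl⟩ := D.vertex_cases hσ v
      · rw [component_rotVertex] at hv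
        cases hv
      · rw [component_refVertex, Option.some_inj, eq_comm, QuotientAddGroup.eq] at hv
        rw [← card_coset _ b]
        refine Nat.card_congr ⟨fun x => ⟨x.1.1, ?_⟩, fun x => ⟨⟨x.1, ?_⟩, ?_⟩, fun x => rfl,
          fun x => rfl⟩
        · exact (D.refVertex_eq_iff hσ).mp (congrArg Subtype.val x.2).symm
        · convert add_mem hv (AddSubgroup.mem_sup_right x.2) using 1
          abel
        · exact Subtype.ext ((D.refVertex_eq_iff hσ).mpr x.2).symm
  rw [card_coset] at h1
  have h2 := (D.fixed ⊔ D.moved).index_mul_card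
  have h3 := D.moved.index_mul_card
  rw [h1, ← h3, ← mul_assoc] at h2
  exact Nat.eq_of_mul_eq_mul_right Nat.card_pos h2

/-- The commuting conjugacy class graph of a nonabelian group with an abelian subgroup of index
two. -/
theorem isCliqueUnion (hσ : ∃ a, D.σ a ≠ a) [Finite A] [Finite G] {k a b : ℕ}
    (hk : (D.fixed ⊔ D.moved).index = k)
    (ha : 2 * a + D.moved.index = Nat.card A) (hb : k * b = D.moved.index) :
    IsCliqueUnion (cccGraph G) k a b := by
  have h1 := D.two_mul_card_rotVertex hσ
  have hk0 : 0 < k := hk ▸ Nat.pos_of_ne_zero AddSubgroup.index_ne_zero_of_finite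
  have hz0 : 0 < D.moved.index := Nat.pos_of_ne_zero AddSubgroup.index_ne_zero_of_finite
  have ha' : Nat.card {v // D.component hσ v = none} = a := by omega
  have hb' : ∀ q, Nat.card {v // D.component hσ v = some q} = b := fun q =>
    Nat.eq_of_mul_eq_mul_left hk0 (by rw [hb, ← D.card_mul_card_refVertex hσ q, hk])
  refine ⟨?_, ?_, _, Fintype.ofFinite _, D.component hσ, hk, D.adj_iff hσ, ha', hb'⟩
  · rw [← ha']
    obtain ⟨d, hd⟩ := hσ
    have : Nonempty {v // D.component ⟨d, hd⟩ v = none} :=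
      ⟨D.rotVertex ⟨d, hd⟩, D.component_rotVertex _ _⟩
    exact Nat.card_pos
  · exact Nat.pos_of_ne_zero fun h => by simp [h] at hb; omega

end IndexTwoData

end IndexTwo
end CCC

namespace CCC

/-! ### Identification of the presented groups with explicit extensions. -/

section Models

/-- The relation lets every power of `b` move to the right past `a`, so words collapse to this
normal form. -/
theorem exists_zpow_mul_zpow {G : Type*} [Group G] (a b : G) {N : ℕ} (hN : 0 < N)
    (ha : a ^ N = 1) (k : ℤ) (hab : b * a = a * b ^ k)
    (hgen : Subgroup.closure {a, b} = ⊤) (g : G) : ∃ i j : ℤ, g = a ^ i * b ^ j := by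
  have hmap : ∀ j : ℤ, b ^ j * a = a * b ^ (k * j) := by
    intro j
    have h := map_zpow (MulAut.conj a⁻¹) b j
    simp only [MulAut.conj_apply, inv_inv, mul_assoc a⁻¹, hab, inv_mul_cancel_left] at h
    rw [zpow_mul, ← h, mul_inv_cancel_left]
  have hpow : ∀ (t : ℕ) (i j : ℤ), ∃ i' j' : ℤ, a ^ i * b ^ j * a ^ t = a ^ i' * b ^ j' := by
    intro t
    induction t with
    | zero => exact fun i j => ⟨i, j, by simp⟩
    | succ t ih =>
      intro i j
      obtain ⟨i', j', h⟩ := ih i j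
      exact ⟨i' + 1, k * j', by rw [pow_succ, ← mul_assoc, h, mul_assoc, hmap, zpow_add_one,
        mul_assoc]⟩
  -- The relation moves powers of `b` past `a` only, not past `a⁻¹`; finite order makes `a⁻¹` a
  -- nonnegative power.
  have ha' : a⁻¹ = a ^ (N - 1) := by
    rw [inv_eq_iff_mul_eq_one, ← pow_succ', Nat.sub_add_cancel hN, ha]
  have hg : g ∈ Subgroup.closure {a, b} := hgen ▸ Subgroup.mem_top g
  induction hg using Subgroup.closure_induction_right with
  | one => exact ⟨0, 0, by simp⟩
  | mul_right x _ y hy hx =>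
    obtain ⟨i, j, rfl⟩ := hx
    rcases hy with rfl | hy
    · simpa using hpow 1 i j
    · rw [Set.mem_singleton_iff.mp hy]
      exact ⟨i, j + 1, by rw [zpow_add_one, mul_assoc]⟩
  | mul_inv_cancel x _ y hy hx =>
    obtain ⟨i, j, rfl⟩ := hx
    rcases hy with rfl | hy
    · rw [ha']
      exact hpow _ i j
    · rw [Set.mem_singleton_iff.mp hy]
      exact ⟨i, j - 1, by rw [zpow_sub_one, mul_assoc]⟩

theorem eq_mul_mul_of_sq_eq_one {G : Type*} [Group G] {a : G} (b : G) (ha : a ^ 2 = 1) :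
    a * (a * b * a) = b * a := by
  rw [← mul_assoc, ← mul_assoc, ← sq, ha, one_mul]

/-- An involution `σ` of an abelian group and a fixed point of it. -/
structure Twist (A : Type) [AddCommGroup A] where
  σ : A →+ A
  c : A
  σ_σ : ∀ a, σ (σ a) = a
  σ_c : σ c = c

/-- The extension of the abelian group `A` by an element `ref 0` acting on `A` as `σ`, whose square
is `rot c`. -/
inductive Twist.Extension {A : Type} [AddCommGroup A] (T : Twist A) : Type
  | rot : A → T.Extension
  | ref : A → T.Extension

namespace Twist

variable {A : Type} [AddCommGroup A] (T : Twist A)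

open Extension

instance : Mul T.Extension where
  mul
    | rot a, rot b => rot (a + b)
    | rot a, ref b => ref (T.σ a + b)
    | ref a, rot b => ref (a + b)
    | ref a, ref b => rot (T.c + T.σ a + b)

instance : One T.Extension := ⟨rot 0⟩

instance : Inv T.Extension where
  inv
    | rot a => rot (-a)
    | ref a => ref (-T.c - T.σ a)

theorem one_def : (1 : T.Extension) = rot 0 := rfl

theorem rot_mul_rot (a b : A) : (rot a * rot b : T.Extension) = rot (a + b) := rfl

theorem rot_mul_ref (a b : A) : (rot a * ref b : T.Extension) = ref (T.σ a + b) := rfl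

theorem ref_mul_rot (a b : A) : (ref a * rot b : T.Extension) = ref (a + b) := rfl

theorem ref_mul_ref (a b : A) : (ref a * ref b : T.Extension) = rot (T.c + T.σ a + b) := rfl

instance : Group T.Extension :=
  Group.ofLeftAxioms
    (by
      rintro (a | a) (b | b) (d | d) <;>
      simp only [rot_mul_rot, rot_mul_ref, ref_mul_rot, ref_mul_ref, map_add, T.σ_σ, T.σ_c,
        Extension.rot.injEq, Extension.ref.injEq] <;>
      abel)
    (by
      rintro (a | a)
      · exact congrArg rot (zero_add a)
      · exact congrArg ref (by rw [map_zero, zero_add]))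
    (by
      rintro (a | a)
      · exact congrArg rot (neg_add_cancel a)
      · refine congrArg rot ?_
        rw [map_sub, map_neg, T.σ_c, T.σ_σ]
        abel)

theorem rot_zpow (a : A) (i : ℤ) : (rot a : T.Extension) ^ i = rot (i • a) :=
  (map_zpow (MonoidHom.mk' (fun x : Multiplicative A => (rot x.toAdd : T.Extension))
    fun _ _ => rfl) (Multiplicative.ofAdd a) i).symm

theorem rot_pow (a : A) (i : ℕ) : (rot a : T.Extension) ^ i = rot (i • a) := by
  rw [← zpow_natCast, rot_zpow, natCast_zsmul]

theorem ref_zero_sq : (ref 0 : T.Extension) ^ 2 = rot T.c := by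
  rw [sq, ref_mul_ref, map_zero, add_zero, add_zero]

theorem ref_zero_zpow_two_mul (i : ℤ) : (ref 0 : T.Extension) ^ (2 * i) = rot (i • T.c) := by
  rw [zpow_mul, zpow_ofNat, ref_zero_sq, rot_zpow]

theorem ref_zero_zpow_two_mul_add_one (i : ℤ) :
    (ref 0 : T.Extension) ^ (2 * i + 1) = ref (i • T.c) := by
  rw [zpow_add_one, ref_zero_zpow_two_mul, rot_mul_ref, map_zsmul, T.σ_c, add_zero]

/-- A group isomorphic to the extension is described by the same data. -/
def indexTwoData {G : Type} [Group G] (e : G ≃* T.Extension) : IndexTwoData A G where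
  rot a := e.symm (rot a)
  ref a := e.symm (ref a)
  σ := T.σ
  c := T.c
  rot_mul_rot a b := by rw [← map_mul, rot_mul_rot]
  rot_mul_ref a b := by rw [← map_mul, rot_mul_ref]
  ref_mul_rot a b := by rw [← map_mul, ref_mul_rot]
  ref_mul_ref a b := by rw [← map_mul, ref_mul_ref]
  bijective := by
    constructor
    · rintro (a | a) (b | b) h <;> simp at h ⊢ <;> exact h
    · intro g
      rcases h : e g with a | a
      · exact ⟨Sum.inl a, by simp [← h]⟩
      · exact ⟨Sum.inr a, by simp [← h]⟩

/-- A homomorphism to an extension from a group with a normal form is an isomorphism, if it is so on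
normal forms. -/
theorem exists_mulEquiv {G : Type} [Group G] (φ : G →* T.Extension) (a b : G) {N : ℕ} (hN : 0 < N)
    (ha : a ^ N = 1) (k : ℤ) (hab : b * a = a * b ^ k) (hgen : Subgroup.closure {a, b} = ⊤)
    {t : A} (hφa : φ a = ref 0) (hφb : φ b = rot t)
    (ht : ∀ x : A, ∃ i j : ℤ, x = i • T.c + j • t)
    (hker : ∀ i j : ℤ, i • T.c + j • t = 0 → a ^ (2 * i) = 1 ∧ b ^ j = 1) :
    Nonempty (G ≃* T.Extension) := by
  refine ⟨MulEquiv.ofBijective φ ⟨?_, ?_⟩⟩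
  · rw [injective_iff_map_eq_one]
    intro g hg
    obtain ⟨i, j, rfl⟩ := exists_zpow_mul_zpow a b hN ha k hab hgen g
    rw [map_mul, map_zpow, map_zpow, hφa, hφb, rot_zpow] at hg
    -- An even power of `a` maps to a rotation, where `hker` decides; an odd power gives a
    -- reflection, which is never the identity.
    obtain ⟨i, rfl | rfl⟩ := Int.even_or_odd' i
    · rw [ref_zero_zpow_two_mul, rot_mul_rot, one_def, Extension.rot.injEq] at hg
      rw [(hker i j hg).1, (hker i j hg).2, one_mul]
    · rw [ref_zero_zpow_two_mul_add_one, ref_mul_rot, one_def] at hg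
      cases hg
  · have hrot : ∀ x, ∃ g, φ g = rot x := by
      intro x
      obtain ⟨i, j, rfl⟩ := ht x
      exact ⟨a ^ (2 * i) * b ^ j, by
        rw [map_mul, map_zpow, map_zpow, hφa, hφb, rot_zpow, ref_zero_zpow_two_mul, rot_mul_rot]⟩
    rintro (x | x)
    · exact hrot x
    · obtain ⟨g, hg⟩ := hrot x
      exact ⟨a * g, by rw [map_mul, hg, hφa, ref_mul_rot, zero_add]⟩

end Twist

/-- The involution of `ℤ/n × ℤ/m` defining `U_{(n,m)}`. -/
def twistU (n m : ℕ) : Twist (ZMod n × ZMod m) where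
  σ := AddMonoidHom.prodMap (AddMonoidHom.id _) (-AddMonoidHom.id _)
  c := (1, 0)
  σ_σ a := Prod.ext rfl (neg_neg a.2)
  σ_c := by simp

theorem exists_mulEquiv_twistU (n m : ℕ) [NeZero n] [NeZero m] :
    Nonempty (GroupU n m ≃* (twistU n m).Extension) := by
  have hn := NeZero.pos n
  -- The subgroup `A` is generated by `x²`, which maps to `rot (1, 0)`, and by `y`; the element `x`
  -- inverts `y`.
  let f : Fin 2 → (twistU n m).Extension := ![.ref 0, .rot (0, 1)]
  have hrels : ∀ r ∈ ({genX ^ (2 * n), genY ^ m, (genX⁻¹ * genY * genX) * (genY⁻¹)⁻¹} :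
      Set (FreeGroup (Fin 2))), FreeGroup.lift f r = 1 := by
    rintro r (rfl | rfl | rfl)
    · simp only [map_pow, genX, FreeGroup.lift_apply_of, f, Matrix.cons_val_zero, pow_mul,
        Twist.ref_zero_sq, Twist.rot_pow, Twist.one_def]
      simp [twistU]
    · simp only [map_pow, genY, FreeGroup.lift_apply_of, f, Matrix.cons_val_one,
        Matrix.cons_val_zero, Twist.rot_pow, Twist.one_def]
      simp
    · rw [map_mul, mul_inv_eq_one.symm, inv_inv]
      simp only [map_mul, map_inv, genX, genY, FreeGroup.lift_apply_of, f, Matrix.cons_val_one,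
        Matrix.cons_val_zero, inv_one, mul_one]
      rw [mul_assoc, mul_assoc, inv_mul_eq_one, ← mul_assoc]
      simp only [Twist.rot_mul_ref, Twist.ref_mul_rot]
      simp [twistU, ← Prod.zero_eq_mk]
  set r := ({genX ^ (2 * n), genY ^ m, (genX⁻¹ * genY * genX) * (genY⁻¹)⁻¹} :
      Set (FreeGroup (Fin 2))) with hr
  have hx : PresentedGroup.mk r genX ^ (2 * n) = 1 := by
    rw [← map_pow]; exact PresentedGroup.one_of_mem (by simp [hr])
  have hy : PresentedGroup.mk r genY ^ m = 1 := by
    rw [← map_pow]; exact PresentedGroup.one_of_mem (by simp [hr])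
  refine (twistU n m).exists_mulEquiv (PresentedGroup.toGroup hrels) _ _ (N := 2 * n) (by omega)
    hx (-1) ?_ (closure_generators _) (t := (0, 1)) (PresentedGroup.toGroup.of hrels)
    (PresentedGroup.toGroup.of hrels) ?_ ?_
  · have : PresentedGroup.mk r (genX⁻¹ * genY * genX) = PresentedGroup.mk r genY⁻¹ :=
      PresentedGroup.mk_eq_mk_of_mul_inv_mem (by simp [hr])
    rw [map_mul, map_mul, map_inv, map_inv, mul_assoc, inv_mul_eq_iff_eq_mul] at this
    rw [this, zpow_neg_one]
  · rintro ⟨x, y⟩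
    obtain ⟨i, rfl⟩ := ZMod.intCast_surjective x
    obtain ⟨j, rfl⟩ := ZMod.intCast_surjective y
    exact ⟨i, j, by simp [twistU]⟩
  · intro i j hij
    have h1 : (i : ZMod n) = 0 ∧ (j : ZMod m) = 0 := by simpa [twistU] using hij
    rw [ZMod.intCast_zmod_eq_zero_iff_dvd, ZMod.intCast_zmod_eq_zero_iff_dvd] at h1
    obtain ⟨⟨i, rfl⟩, ⟨j, rfl⟩⟩ := h1
    constructor
    · rw [← mul_assoc, zpow_mul, show (2 * n : ℤ) = (2 * n : ℕ) by push_cast; rfl, zpow_natCast, hx,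
        one_zpow]
    · rw [zpow_mul, zpow_natCast, hy, one_zpow]

/-- The involution of `ℤ/4n` defining `SD_{8n}`. -/
def twistSD (n : ℕ) : Twist (ZMod (4 * n)) where
  σ := AddMonoidHom.mulLeft (2 * n - 1)
  c := 0
  σ_σ a := by
    have h : (4 * n : ZMod (4 * n)) = 0 := by exact_mod_cast ZMod.natCast_self (4 * n)
    simp only [AddMonoidHom.coe_mulLeft]
    -- This is `(2n - 1)² = 1 + (n - 1) · 4n`.
    linear_combination (n - 1 : ZMod (4 * n)) * a * h
  σ_c := map_zero _

/-- Here `A` is generated by `x`, and `y` is the reflection; thus the generators exchange the roles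
they have in `U_{(n,m)}`. -/
theorem exists_mulEquiv_twistSD (n : ℕ) [NeZero n] :
    Nonempty (GroupSD n ≃* (twistSD n).Extension) := by
  have hn := NeZero.pos n
  let f : Fin 2 → (twistSD n).Extension := ![.rot 1, .ref 0]
  have hrels : ∀ r ∈ ({genX ^ (4 * n), genY ^ 2, (genY * genX * genY) * (genX ^ (2 * n - 1))⁻¹} :
      Set (FreeGroup (Fin 2))), FreeGroup.lift f r = 1 := by
    rintro r (rfl | rfl | rfl)
    · simp only [map_pow, genX, FreeGroup.lift_apply_of, f, Matrix.cons_val_zero,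
        Twist.rot_pow, Twist.one_def]
      simp only [nsmul_eq_mul, ZMod.natCast_self, zero_mul]
    · simp only [map_pow, genY, FreeGroup.lift_apply_of, f, Matrix.cons_val_one,
        Matrix.cons_val_zero, Twist.ref_zero_sq, Twist.one_def]
      simp [twistSD]
    · rw [map_mul, map_inv, mul_inv_eq_one]
      simp only [map_mul, map_pow, genX, genY, FreeGroup.lift_apply_of, f, Matrix.cons_val_one,
        Matrix.cons_val_zero, Twist.ref_mul_rot, Twist.ref_mul_ref, Twist.rot_pow]
      have : ((2 * n - 1 : ℕ) : ZMod (4 * n)) = 2 * n - 1 := by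
        rw [Nat.cast_sub (by omega)]; push_cast; rfl
      simp [twistSD, this]
  set r := ({genX ^ (4 * n), genY ^ 2, (genY * genX * genY) * (genX ^ (2 * n - 1))⁻¹} :
      Set (FreeGroup (Fin 2))) with hr
  have hx : PresentedGroup.mk r genX ^ (4 * n) = 1 := by
    rw [← map_pow]; exact PresentedGroup.one_of_mem (by simp [hr])
  have hy : PresentedGroup.mk r genY ^ 2 = 1 := by
    rw [← map_pow]; exact PresentedGroup.one_of_mem (by simp [hr])
  refine (twistSD n).exists_mulEquiv (PresentedGroup.toGroup hrels) (PresentedGroup.mk r genY)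
    (PresentedGroup.mk r genX) (N := 2) (by omega)
    hy ((2 * n - 1 : ℕ) : ℤ) ?_ (Set.pair_comm (PresentedGroup.mk r genX) _ ▸ closure_generators _) (t := 1)
    (PresentedGroup.toGroup.of hrels) (PresentedGroup.toGroup.of hrels) ?_ ?_
  · have h : PresentedGroup.mk r (genY * genX * genY) = PresentedGroup.mk r (genX ^ (2 * n - 1)) :=
      PresentedGroup.mk_eq_mk_of_mul_inv_mem (by simp [hr])
    rw [map_mul, map_mul, map_pow] at h
    rw [zpow_natCast, ← h, eq_mul_mul_of_sq_eq_one _ hy]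
  · intro x
    obtain ⟨i, rfl⟩ := ZMod.intCast_surjective x
    exact ⟨0, i, by simp⟩
  · intro i j hij
    have h1 : (j : ZMod (4 * n)) = 0 := by simpa [twistSD] using hij
    rw [ZMod.intCast_zmod_eq_zero_iff_dvd] at h1
    obtain ⟨j, rfl⟩ := h1
    constructor
    · rw [zpow_mul, zpow_ofNat, hy, one_zpow]
    · rw [zpow_mul, zpow_natCast, hx, one_zpow]

end Models
end CCC

namespace CCC

/-! ### Indices of `moved` and `fixed ⊔ moved`, and the shape of the graph for each family. -/

section Families

/-- Such a subgroup is the kernel of the surjective reduction `ℤ/N → ℤ/d`. -/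
theorem index_eq_of_intCast_mem_iff {N d : ℕ} (hd : d ∣ N) (H : AddSubgroup (ZMod N))
    (h : ∀ x : ℤ, (x : ZMod N) ∈ H ↔ (d : ℤ) ∣ x) : H.index = d := by
  have hH : H = (ZMod.castHom hd (ZMod d)).toAddMonoidHom.ker := by
    ext y
    obtain ⟨x, rfl⟩ := ZMod.intCast_surjective y
    rw [h, AddMonoidHom.mem_ker, ← ZMod.intCast_zmod_eq_zero_iff_dvd]
    simp
  rw [hH, AddSubgroup.index_ker, AddMonoidHom.range_eq_top.mpr (ZMod.castHom_surjective hd),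
    AddSubgroup.card_top, Nat.card_zmod]

/-- The homomorphism `σ - 1` of `ℤ/m` for the inversion `σ`. -/
def negSubId (m : ℕ) : ZMod m →+ ZMod m := -AddMonoidHom.id (ZMod m) - AddMonoidHom.id (ZMod m)

theorem intCast_mem_range_negSubId {m : ℕ} {x : ℤ} :
    (x : ZMod m) ∈ (negSubId m).range ↔ ∃ t s : ℤ, x = 2 * t + m * s := by
  constructor
  · rintro ⟨y, hy⟩
    obtain ⟨t, rfl⟩ := ZMod.intCast_surjective y
    have h : ((x + 2 * t : ℤ) : ZMod m) = 0 := by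
      push_cast
      rw [← hy]
      simp only [negSubId, AddMonoidHom.sub_apply, AddMonoidHom.neg_apply, AddMonoidHom.id_apply]
      ring
    obtain ⟨s, hs⟩ := (ZMod.intCast_zmod_eq_zero_iff_dvd _ _).mp h
    exact ⟨-t, s, by linarith⟩
  · rintro ⟨t, s, rfl⟩
    refine ⟨((-t : ℤ) : ZMod m), ?_⟩
    simp [negSubId]
    ring

theorem intCast_mem_ker_negSubId {m : ℕ} {x : ℤ} :
    (x : ZMod m) ∈ (negSubId m).ker ↔ (m : ℤ) ∣ 2 * x := by
  rw [AddMonoidHom.mem_ker, ← ZMod.intCast_zmod_eq_zero_iff_dvd, ← neg_eq_zero]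
  simp [negSubId, two_mul, sub_eq_add_neg]

theorem index_range_negSubId (m : ℕ) :
    (negSubId m).range.index = if m % 2 = 0 then 2 else 1 := by
  split_ifs with h
  · refine index_eq_of_intCast_mem_iff (Nat.dvd_of_mod_eq_zero h) _ fun x => ?_
    rw [intCast_mem_range_negSubId]
    obtain ⟨l, rfl⟩ := Nat.dvd_of_mod_eq_zero h
    constructor
    · rintro ⟨t, s, rfl⟩
      exact ⟨t + l * s, by push_cast; ring⟩
    · rintro ⟨t, rfl⟩
      exact ⟨t, 0, by simp⟩
  · refine index_eq_of_intCast_mem_iff (one_dvd m) _ fun x => ?_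
    rw [intCast_mem_range_negSubId]
    obtain ⟨l, rfl⟩ : ∃ l, m = 2 * l + 1 := ⟨m / 2, by omega⟩
    exact iff_of_true ⟨-l * x, x, by push_cast; ring⟩ (by simp)

/-- The range consists of the multiples of `2` and the kernel is the 2-torsion. For even `m` the
latter is generated by `m/2`, which is itself even exactly when `4 ∣ m`; for odd `m` the range is
everything. -/
theorem index_ker_sup_range_negSubId (m : ℕ) :
    ((negSubId m).ker ⊔ (negSubId m).range).index = if m % 4 = 0 then 2 else 1 := by
  split_ifs with h
  · rw [sup_eq_right.mpr, index_range_negSubId, if_pos (by omega)]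
    intro y hy
    obtain ⟨x, rfl⟩ := ZMod.intCast_surjective y
    rw [intCast_mem_ker_negSubId] at hy
    rw [intCast_mem_range_negSubId]
    obtain ⟨l, rfl⟩ := Nat.dvd_of_mod_eq_zero h
    obtain ⟨t, ht⟩ := hy
    push_cast at ht
    exact ⟨l * t, 0, by linarith⟩
  · rw [AddSubgroup.index_eq_one, eq_top_iff]
    by_cases h2 : m % 2 = 0
    · obtain ⟨l, rfl⟩ : ∃ l, m = 4 * l + 2 := ⟨m / 4, by omega⟩
      rintro y -
      obtain ⟨x, rfl⟩ := ZMod.intCast_surjective y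
      -- As `m/2 = 2l + 1` is odd, `x = (2l + 1)x - 2lx` splits into a torsion part and an even
      -- part.
      have h1 : (((2 * l + 1) * x : ℤ) : ZMod (4 * l + 2)) ∈ (negSubId (4 * l + 2)).ker :=
        intCast_mem_ker_negSubId.mpr ⟨x, by push_cast; ring⟩
      have h2 : ((-2 * l * x : ℤ) : ZMod (4 * l + 2)) ∈ (negSubId (4 * l + 2)).range :=
        intCast_mem_range_negSubId.mpr ⟨-l * x, 0, by ring⟩
      have h3 := add_mem (AddSubgroup.mem_sup_left (T := (negSubId (4 * l + 2)).range) h1)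
        (AddSubgroup.mem_sup_right h2)
      convert h3 using 1
      push_cast
      ring
    · rw [AddSubgroup.index_eq_one.mp ((index_range_negSubId m).trans (if_neg h2))]
      exact le_sup_right

/-- The dihedral group as an extension of its rotations. -/
def dihedralData (n : ℕ) : IndexTwoData (ZMod n) (DihedralGroup n) where
  rot := DihedralGroup.r
  ref := DihedralGroup.sr
  σ := -AddMonoidHom.id _
  c := 0
  rot_mul_rot := DihedralGroup.r_mul_r
  rot_mul_ref a b := by
    rw [DihedralGroup.r_mul_sr, AddMonoidHom.neg_apply, AddMonoidHom.id_apply, neg_add_eq_sub]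
  ref_mul_rot := DihedralGroup.sr_mul_r
  ref_mul_ref a b := by
    rw [DihedralGroup.sr_mul_sr, AddMonoidHom.neg_apply, AddMonoidHom.id_apply, zero_add,
      neg_add_eq_sub]
  bijective := by
    constructor
    · rintro (a | a) (b | b) h <;> simp at h ⊢ <;> exact h
    · rintro (a | a)
      · exact ⟨Sum.inl a, rfl⟩
      · exact ⟨Sum.inr a, rfl⟩

/-- The dicyclic group as an extension of its cyclic subgroup. -/
def quaternionData (n : ℕ) : IndexTwoData (ZMod (2 * n)) (QuaternionGroup n) where
  rot := QuaternionGroup.a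
  ref := QuaternionGroup.xa
  σ := -AddMonoidHom.id _
  c := n
  rot_mul_rot := QuaternionGroup.a_mul_a
  rot_mul_ref a b := by
    rw [QuaternionGroup.a_mul_xa, AddMonoidHom.neg_apply, AddMonoidHom.id_apply, neg_add_eq_sub]
  ref_mul_rot := QuaternionGroup.xa_mul_a
  ref_mul_ref a b := by
    rw [QuaternionGroup.xa_mul_xa, AddMonoidHom.neg_apply, AddMonoidHom.id_apply, add_assoc,
      neg_add_eq_sub, add_sub_assoc]
  bijective := by
    constructor
    · rintro (a | a) (b | b) h <;> simp at h ⊢ <;> exact h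
    · rintro (a | a)
      · exact ⟨Sum.inl a, rfl⟩
      · exact ⟨Sum.inr a, rfl⟩

theorem exists_neg_ne {m : ℕ} (hm : 3 ≤ m) :
    ∃ a : ZMod m, (-AddMonoidHom.id (ZMod m)) a ≠ a := by
  refine ⟨1, fun h => ?_⟩
  rw [AddMonoidHom.neg_apply, AddMonoidHom.id_apply, neg_eq_iff_add_eq_zero] at h
  have h2 : ((2 : ℕ) : ZMod m) = 0 := by
    push_cast
    rw [← h]
    ring
  have := Nat.le_of_dvd two_pos ((ZMod.natCast_eq_zero_iff 2 m).mp h2)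
  omega

theorem isCliqueUnion_dihedral (n : ℕ) [NeZero n] (hn : 3 ≤ n) {k a b : ℕ}
    (hk : (if n % 4 = 0 then 2 else 1) = k) (ha : 2 * a + (if n % 2 = 0 then 2 else 1) = n)
    (hb : k * b = if n % 2 = 0 then 2 else 1) :
    IsCliqueUnion (cccGraph (DihedralGroup n)) k a b := by
  have hm : (dihedralData n).moved.index = if n % 2 = 0 then 2 else 1 := index_range_negSubId n
  refine (dihedralData n).isCliqueUnion (exists_neg_ne hn)
    ((index_ker_sup_range_negSubId n).trans hk) ?_ (hb.trans hm.symm)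
  rw [hm, ha, Nat.card_zmod]

theorem isCliqueUnion_quaternion (n : ℕ) [NeZero n] (hn : 2 ≤ n) {k a b : ℕ}
    (hk : (if n % 2 = 0 then 2 else 1) = k) (ha : a + 1 = n) (hb : k * b = 2) :
    IsCliqueUnion (cccGraph (QuaternionGroup n)) k a b := by
  have hm : (quaternionData n).moved.index = 2 :=
    (index_range_negSubId _).trans (if_pos (by omega))
  refine (quaternionData n).isCliqueUnion (exists_neg_ne (by omega))
    ((index_ker_sup_range_negSubId _).trans ?_) ?_ (hb.trans hm.symm)
  · rw [← hk]
    split_ifs <;> omega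
  · rw [hm, Nat.card_zmod]
    omega

theorem intCast_mem_twistSD_range {n : ℕ} {x : ℤ} :
    (x : ZMod (4 * n)) ∈ ((twistSD n).σ - AddMonoidHom.id _).range ↔
      ∃ t s : ℤ, x = (2 * n - 2) * t + 4 * n * s := by
  constructor
  · rintro ⟨y, hy⟩
    obtain ⟨t, rfl⟩ := ZMod.intCast_surjective y
    have h : ((x - (2 * n - 2) * t : ℤ) : ZMod (4 * n)) = 0 := by
      push_cast
      rw [← hy]
      simp only [twistSD, AddMonoidHom.sub_apply, AddMonoidHom.coe_mulLeft, AddMonoidHom.id_apply]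
      ring
    obtain ⟨s, hs⟩ := (ZMod.intCast_zmod_eq_zero_iff_dvd _ _).mp h
    push_cast at hs
    exact ⟨t, s, by linarith⟩
  · rintro ⟨t, s, rfl⟩
    refine ⟨(t : ZMod (4 * n)), ?_⟩
    have h : (4 * n : ZMod (4 * n)) = 0 := by exact_mod_cast ZMod.natCast_self (4 * n)
    simp only [twistSD, AddMonoidHom.sub_apply, AddMonoidHom.coe_mulLeft, AddMonoidHom.id_apply]
    push_cast
    linear_combination -(s : ZMod (4 * n)) * h

theorem intCast_mem_twistSD_ker {n : ℕ} {x : ℤ} :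
    (x : ZMod (4 * n)) ∈ ((twistSD n).σ - AddMonoidHom.id _).ker ↔
      (4 * n : ℤ) ∣ (2 * n - 2) * x := by
  rw [AddMonoidHom.mem_ker, show (4 * n : ℤ) = (4 * n : ℕ) by push_cast; rfl,
    ← ZMod.intCast_zmod_eq_zero_iff_dvd]
  simp only [twistSD, AddMonoidHom.sub_apply, AddMonoidHom.coe_mulLeft, AddMonoidHom.id_apply]
  push_cast
  refine iff_of_eq (congrArg (· = 0) ?_)
  ring

/-- Since `σ - 1` is multiplication by `2n - 2`, the index is `gcd(2n - 2, 4n)`; the witnesses are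
Bézout coefficients. -/
theorem index_twistSD_range (n : ℕ) :
    ((twistSD n).σ - AddMonoidHom.id _).range.index = if n % 2 = 0 then 2 else 4 := by
  split_ifs with h
  · refine index_eq_of_intCast_mem_iff (Dvd.intro (2 * n) (by ring)) _ fun x => ?_
    rw [intCast_mem_twistSD_range]
    obtain ⟨l, rfl⟩ := Nat.dvd_of_mod_eq_zero h
    constructor
    · rintro ⟨t, s, rfl⟩
      exact ⟨(2 * l - 1) * t + 4 * l * s, by push_cast; ring⟩
    · rintro ⟨t, rfl⟩
      exact ⟨(2 * l - 1) * t, (1 - l) * t, by push_cast; ring⟩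
  · refine index_eq_of_intCast_mem_iff (Dvd.intro n rfl) _ fun x => ?_
    rw [intCast_mem_twistSD_range]
    obtain ⟨l, rfl⟩ : ∃ l, n = 2 * l + 1 := ⟨n / 2, by omega⟩
    constructor
    · rintro ⟨t, s, rfl⟩
      exact ⟨l * t + (2 * l + 1) * s, by push_cast; ring⟩
    · rintro ⟨t, rfl⟩
      exact ⟨-2 * t, t, by push_cast; ring⟩

theorem index_twistSD_ker_sup_range (n : ℕ) :
    (((twistSD n).σ - AddMonoidHom.id _).ker ⊔ ((twistSD n).σ - AddMonoidHom.id _).range).index =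
      if n % 2 = 0 then 2 else 1 := by
  split_ifs with h
  · rw [sup_eq_right.mpr, index_twistSD_range, if_pos h]
    intro y hy
    obtain ⟨x, rfl⟩ := ZMod.intCast_surjective y
    rw [intCast_mem_twistSD_ker] at hy
    rw [intCast_mem_twistSD_range]
    obtain ⟨l, rfl⟩ := Nat.dvd_of_mod_eq_zero h
    obtain ⟨t, ht⟩ := hy
    push_cast at ht ⊢
    -- With `n = 2l`, the kernel condition reads `(2l - 1)x = 4lt`, which forces `x` to be even.
    have hx : x = 2 * (l * x - 2 * l * t) := by linarith
    generalize l * x - 2 * l * t = u at hx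
    subst hx
    exact ⟨(2 * l - 1) * u, (1 - l) * u, by ring⟩
  · rw [AddSubgroup.index_eq_one, eq_top_iff]
    obtain ⟨l, rfl⟩ : ∃ l, n = 2 * l + 1 := ⟨n / 2, by omega⟩
    rintro y -
    obtain ⟨x, rfl⟩ := ZMod.intCast_surjective y
    -- The splitting comes from `1 = n² - 4(l² + l)`: multiples of `n` are in the kernel because `4
    -- ∣ 2n - 2`, and multiples of `4` are in the range.
    have h1 : (((2 * l + 1) ^ 2 * x : ℤ) : ZMod (4 * (2 * l + 1))) ∈
        ((twistSD (2 * l + 1)).σ - AddMonoidHom.id _).ker :=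
      intCast_mem_twistSD_ker.mpr ⟨l * (2 * l + 1) * x, by push_cast; ring⟩
    have h2 : ((-4 * (l ^ 2 + l) * x : ℤ) : ZMod (4 * (2 * l + 1))) ∈
        ((twistSD (2 * l + 1)).σ - AddMonoidHom.id _).range :=
      intCast_mem_twistSD_range.mpr ⟨2 * (l ^ 2 + l) * x, -(l ^ 2 + l) * x, by push_cast; ring⟩
    have h3 := add_mem (AddSubgroup.mem_sup_left
      (T := ((twistSD (2 * l + 1)).σ - AddMonoidHom.id _).range) h1)
      (AddSubgroup.mem_sup_right h2)
    convert h3 using 1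
    push_cast
    ring

theorem isCliqueUnion_semidihedral (n : ℕ) [NeZero n] (hn : 2 ≤ n) {k a b : ℕ}
    (hk : (if n % 2 = 0 then 2 else 1) = k) (ha : 2 * a + (if n % 2 = 0 then 2 else 4) = 4 * n)
    (hb : k * b = if n % 2 = 0 then 2 else 4) :
    IsCliqueUnion (cccGraph (GroupSD n)) k a b := by
  obtain ⟨e⟩ := exists_mulEquiv_twistSD n
  have hm : ((twistSD n).indexTwoData e).moved.index = if n % 2 = 0 then 2 else 4 :=
    index_twistSD_range n
  have : NeZero (4 * n) := ⟨by omega⟩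
  refine ((twistSD n).indexTwoData e).isCliqueUnion ?_
    ((index_twistSD_ker_sup_range n).trans hk) ?_ (hb.trans hm.symm)
  · refine ⟨((1 : ℤ) : ZMod (4 * n)), fun h => ?_⟩
    have h2 := intCast_mem_twistSD_ker.mp (((twistSD n).indexTwoData e).mem_fixed.mpr h)
    have := Int.le_of_dvd (by omega) h2
    omega
  · rw [hm, ha, Nat.card_zmod]

theorem twistU_sub_id (n m : ℕ) :
    (twistU n m).σ - AddMonoidHom.id _ = AddMonoidHom.prodMap 0 (negSubId m) := by
  ext <;> simp [twistU, negSubId]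

theorem index_twistU_range (n m : ℕ) :
    ((twistU n m).σ - AddMonoidHom.id _).range.index = n * if m % 2 = 0 then 2 else 1 := by
  rw [twistU_sub_id, AddMonoidHom.range_prodMap, AddSubgroup.index_prod, index_range_negSubId,
    AddMonoidHom.range_zero, AddSubgroup.index_bot, Nat.card_zmod]

/-- The factor `ℤ/n` is fixed pointwise and disappears in the quotient, leaving the computation for
inversion on `ℤ/m`. -/
theorem index_twistU_ker_sup_range (n m : ℕ) :
    (((twistU n m).σ - AddMonoidHom.id _).ker ⊔
      ((twistU n m).σ - AddMonoidHom.id _).range).index = if m % 4 = 0 then 2 else 1 := by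
  have h : (AddMonoidHom.prodMap (0 : ZMod n →+ ZMod n) (negSubId m)).ker ⊔
      (AddMonoidHom.prodMap (0 : ZMod n →+ ZMod n) (negSubId m)).range =
      (⊤ : AddSubgroup (ZMod n)).prod ((negSubId m).ker ⊔ (negSubId m).range) := by
    rw [AddMonoidHom.ker_prodMap, AddMonoidHom.range_prodMap, AddMonoidHom.ker_zero]
    apply le_antisymm
    · exact sup_le (AddSubgroup.prod_mono le_rfl le_sup_left)
        (AddSubgroup.prod_mono le_top le_sup_right)
    · rintro ⟨x, y⟩ ⟨-, hy⟩
      obtain ⟨u, hu, v, hv, rfl⟩ := AddSubgroup.mem_sup.mp hy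
      exact AddSubgroup.mem_sup.mpr ⟨(x, u), ⟨trivial, hu⟩, (0, v), ⟨zero_mem _, hv⟩, by simp⟩
  rw [twistU_sub_id, h, AddSubgroup.index_prod, AddSubgroup.index_top, one_mul,
    index_ker_sup_range_negSubId]

theorem isCliqueUnion_groupU (n m : ℕ) [NeZero n] [NeZero m] (hm : 3 ≤ m) {k a b : ℕ}
    (hk : (if m % 4 = 0 then 2 else 1) = k)
    (ha : 2 * a + n * (if m % 2 = 0 then 2 else 1) = n * m)
    (hb : k * b = n * if m % 2 = 0 then 2 else 1) :
    IsCliqueUnion (cccGraph (GroupU n m)) k a b := by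
  obtain ⟨e⟩ := exists_mulEquiv_twistU n m
  have hi : ((twistU n m).indexTwoData e).moved.index = n * if m % 2 = 0 then 2 else 1 :=
    index_twistU_range n m
  refine ((twistU n m).indexTwoData e).isCliqueUnion ?_
    ((index_twistU_ker_sup_range n m).trans hk) ?_ (hb.trans hi.symm)
  · obtain ⟨y, hy⟩ := exists_neg_ne hm
    exact ⟨(0, y), fun h => hy (congrArg Prod.snd h)⟩
  · rw [hi, ha, Nat.card_prod, Nat.card_zmod, Nat.card_zmod]

theorem IndexTwoData.isEmpty_vertex {A G : Type} [AddCommGroup A] [Group G]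
    (D : IndexTwoData A G) (hσ : ∀ a, D.σ a = a) : IsEmpty (Vertex G) := by
  refine ⟨fun ⟨_, x, hx, _⟩ => hx (Subgroup.mem_center_iff.mpr fun g => ?_)⟩
  obtain ⟨a, rfl⟩ | ⟨a, rfl⟩ := D.cases x <;> obtain ⟨b, rfl⟩ | ⟨b, rfl⟩ := D.cases g
  · exact D.rot_comm _ _
  · exact (D.rot_comm_ref_iff.mpr (hσ _)).symm
  · exact D.rot_comm_ref_iff.mpr (hσ _)
  · exact D.ref_comm_ref_iff.mpr (D.mem_fixed.mpr (hσ _))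

/-- The group `U_{(n,2)}` is abelian. -/
theorem isEmpty_vertex_groupU_two (n : ℕ) [NeZero n] : IsEmpty (Vertex (GroupU n 2)) := by
  obtain ⟨e⟩ := exists_mulEquiv_twistU n 2
  exact ((twistU n 2).indexTwoData e).isEmpty_vertex fun a =>
    Prod.ext rfl (ZMod.neg_eq_self_mod_two a.2)

end Families
end CCC

namespace CCC

/-! ### Translation of clique sizes into group parameters. -/

section Classification

variable {V : Type*} [Fintype V] {G : SimpleGraph V}

theorem IsCliqueUnion.classification {k a b : ℕ} (h : IsCliqueUnion G k a b) {p q : Prop}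
    (hL : (cliqueTop k a b < cliqueL k a b ↔ p) ∧ cliqueL k a b ≠ cliqueTop k a b)
    (hS : (cliqueTop k a b < cliqueS k a b ↔ q) ∧ cliqueS k a b ≠ cliqueTop k a b) :
    ¬ IsCNLBorderenergetic G ∧ (IsCNLHyperenergetic G ↔ p) ∧
      ¬ IsCNSLBorderenergetic G ∧ (IsCNSLHyperenergetic G ↔ q) := by
  rw [h.isCNLBorderenergetic_iff, h.isCNLHyperenergetic_iff, h.isCNSLBorderenergetic_iff,
    h.isCNSLHyperenergetic_iff]
  exact ⟨hL.2, hL.1, hS.2, hS.1⟩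

theorem classification_of_isEmpty [IsEmpty V] :
    IsCNLBorderenergetic G ∧ ¬ IsCNLHyperenergetic G ∧
      IsCNSLBorderenergetic G ∧ ¬ IsCNSLHyperenergetic G := by
  obtain rfl : G = ⊤ := by
    ext u
    exact isEmptyElim u
  exact ⟨rfl, lt_irrefl _, rfl, lt_irrefl _⟩

/-- For odd `n` the graph is `K_{(n-1)/2}` with an isolated vertex, whence the borderline values `n
= 3, 11`. For even `n` it is `K_{n/2-1}` with two further vertices, joined iff `4 ∤ n`. -/
theorem classification_dihedral (n : ℕ) [NeZero n] (hn : 3 ≤ n) :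
    (IsCNLBorderenergetic (cccGraph (DihedralGroup n)) ↔ n = 3 ∨ n = 11) ∧
    (IsCNLHyperenergetic (cccGraph (DihedralGroup n)) ↔ 13 ≤ n) ∧
    (IsCNSLBorderenergetic (cccGraph (DihedralGroup n)) ↔ n = 3) ∧
    (IsCNSLHyperenergetic (cccGraph (DihedralGroup n)) ↔ Even n ∧ 20 ≤ n) := by
  rw [Nat.even_iff]
  by_cases h2 : n % 2 = 0
  · obtain ⟨k, b, hkb, hk⟩ : ∃ k b, (k = 2 ∧ b = 1 ∨ k = 1 ∧ b = 2) ∧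
        (if n % 4 = 0 then 2 else 1) = k := by
      split_ifs
      · exact ⟨2, 1, by simp, rfl⟩
      · exact ⟨1, 2, by simp, rfl⟩
    have h := (isCliqueUnion_dihedral n hn hk (a := n / 2 - 1) (b := b)
      (by rw [if_pos h2]; omega)
      (by rw [if_pos h2]; rcases hkb with ⟨rfl, rfl⟩ | ⟨rfl, rfl⟩ <;> rfl)).classification
      (cliqueL_two hkb (by omega)) (cliqueS_two hkb (by omega))
    exact ⟨iff_of_false h.1 (by omega), h.2.1.trans (by omega), iff_of_false h.2.2.1 (by omega),
      h.2.2.2.trans (by omega)⟩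
  · have h := isCliqueUnion_dihedral n hn (k := 1) (a := n / 2) (b := 1)
      (if_neg (by omega)) (by rw [if_neg h2]; omega) (by rw [if_neg h2])
    have hL := cliqueL_one_one (a := n / 2) (by omega)
    have hS := cliqueS_one_one (a := n / 2) (by omega)
    rw [h.isCNLBorderenergetic_iff, h.isCNLHyperenergetic_iff, h.isCNSLBorderenergetic_iff,
      h.isCNSLHyperenergetic_iff, Nat.cast_one]
    exact ⟨hL.2.trans (by omega), hL.1.trans (by omega), hS.2.trans (by omega),
      iff_of_false hS.1 (by omega)⟩

theorem classification_quaternion (n : ℕ) [NeZero n] (hn : 2 ≤ n) :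
    ¬ IsCNLBorderenergetic (cccGraph (QuaternionGroup n)) ∧
    (IsCNLHyperenergetic (cccGraph (QuaternionGroup n)) ↔ 7 ≤ n) ∧
    ¬ IsCNSLBorderenergetic (cccGraph (QuaternionGroup n)) ∧
    (IsCNSLHyperenergetic (cccGraph (QuaternionGroup n)) ↔ 10 ≤ n) := by
  obtain ⟨k, b, hkb, hk⟩ : ∃ k b, (k = 2 ∧ b = 1 ∨ k = 1 ∧ b = 2) ∧
      (if n % 2 = 0 then 2 else 1) = k := by
    split_ifs
    · exact ⟨2, 1, by simp, rfl⟩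
    · exact ⟨1, 2, by simp, rfl⟩
  have h := (isCliqueUnion_quaternion n hn hk (a := n - 1) (b := b) (by omega)
    (by rcases hkb with ⟨rfl, rfl⟩ | ⟨rfl, rfl⟩ <;> rfl)).classification
    (cliqueL_two hkb (by omega)) (cliqueS_two hkb (by omega))
  exact ⟨h.1, h.2.1.trans (by omega), h.2.2.1, h.2.2.2.trans (by omega)⟩

theorem classification_semidihedral (n : ℕ) [NeZero n] (hn : 2 ≤ n) :
    ¬ IsCNLBorderenergetic (cccGraph (GroupSD n)) ∧
    (IsCNLHyperenergetic (cccGraph (GroupSD n)) ↔ 4 ≤ n) ∧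
    ¬ IsCNSLBorderenergetic (cccGraph (GroupSD n)) ∧
    (IsCNSLHyperenergetic (cccGraph (GroupSD n)) ↔ 6 ≤ n) := by
  by_cases h2 : n % 2 = 0
  · have h := (isCliqueUnion_semidihedral n hn (k := 2) (a := 2 * n - 1) (b := 1) (if_pos h2)
      (by rw [if_pos h2]; omega) (by rw [if_pos h2])).classification
      (cliqueL_two (by simp) (by omega)) (cliqueS_two (by simp) (by omega))
    exact ⟨h.1, h.2.1.trans (by omega), h.2.2.1, h.2.2.2.trans (by omega)⟩
  · have h := (isCliqueUnion_semidihedral n hn (k := 1) (a := 2 * n - 2) (b := 4) (if_neg h2)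
      (by rw [if_neg h2]; omega) (by rw [if_neg h2])).classification
      (cliqueL_four (by omega)) (cliqueS_four (by omega))
    exact ⟨h.1, h.2.1.trans (by omega), h.2.2.1, h.2.2.2.trans (by omega)⟩

/-- The ratio of the large clique to the others is `(m - 1)/2` for odd `m`, `(m - 2)/4` for `m ≡ 2`
and `m/2 - 1` for `m ≡ 0` modulo `4`. For `m ≡ 2` the small clique has size `2n ≥ 4`, so fewer
exceptions survive there. -/
theorem classification_groupU (n m : ℕ) [NeZero n] [NeZero m] (hn : 2 ≤ n) (hm : 3 ≤ m) :
    ¬ IsCNLBorderenergetic (cccGraph (GroupU n m)) ∧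
    (IsCNLHyperenergetic (cccGraph (GroupU n m)) ↔
      ¬ (m = 3 ∨ (m = 5 ∧ (n = 2 ∨ n = 3)) ∨ m = 4 ∨ (m = 8 ∧ n = 2) ∨ m = 6)) ∧
    ¬ IsCNSLBorderenergetic (cccGraph (GroupU n m)) ∧
    (IsCNSLHyperenergetic (cccGraph (GroupU n m)) ↔
      ¬ (m = 3 ∨ ((m = 5 ∨ m = 7 ∨ m = 9) ∧ n = 2) ∨ (m = 5 ∧ (n = 3 ∨ n = 4)) ∨
        m = 4 ∨ (m = 8 ∧ n = 2) ∨ m = 6 ∨ (m = 10 ∧ n = 2))) := by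
  obtain h2 | h2 | h2 : m % 2 = 1 ∨ m % 4 = 2 ∨ m % 4 = 0 := by omega
  · obtain ⟨q, rfl⟩ : ∃ q, m = 2 * q + 1 := ⟨m / 2, by omega⟩
    have h := (isCliqueUnion_groupU n _ hm (k := 1) (a := n * q) (b := n) (if_neg (by omega))
      (by rw [if_neg (by omega)]; ring) (by rw [if_neg (by omega)]; ring)).classification
      (cliqueL_one_mul (by omega) hn) (cliqueS_one_mul (by omega) hn)
    exact ⟨h.1, h.2.1.trans (by omega), h.2.2.1, h.2.2.2.trans (by omega)⟩
  · obtain ⟨q, rfl⟩ : ∃ q, m = 4 * q + 2 := ⟨m / 4, by omega⟩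
    have h := (isCliqueUnion_groupU n _ hm (k := 1) (a := 2 * n * q) (b := 2 * n)
      (if_neg (by omega)) (by rw [if_pos (by omega)]; ring)
      (by rw [if_pos (by omega)]; ring)).classification
      (cliqueL_one_mul (by omega) (by omega)) (cliqueS_one_mul (by omega) (by omega))
    exact ⟨h.1, h.2.1.trans (by omega), h.2.2.1, h.2.2.2.trans (by omega)⟩
  · obtain ⟨q, rfl⟩ : ∃ q, m = 4 * q + 4 := ⟨m / 4 - 1, by omega⟩
    have h := (isCliqueUnion_groupU n _ hm (k := 2) (a := n * (2 * q + 1)) (b := n)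
      (if_pos (by omega)) (by rw [if_pos (by omega)]; ring)
      (by rw [if_pos (by omega)]; ring)).classification
      (cliqueL_two_mul (by omega) hn) (cliqueS_two_mul (by omega) hn)
    exact ⟨h.1, h.2.1.trans (by omega), h.2.2.1, h.2.2.2.trans (by omega)⟩

end Classification
end CCC

theorem mainTheorem4 :
    -- the dihedral groups `D_{2n}`
    (∀ (n : ℕ) [NeZero n], 3 ≤ n →
      (CCC.IsCNLBorderenergetic (CCC.cccGraph (DihedralGroup n)) ↔ n = 3 ∨ n = 11) ∧
      (CCC.IsCNLHyperenergetic (CCC.cccGraph (DihedralGroup n)) ↔ 13 ≤ n) ∧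
      (CCC.IsCNSLBorderenergetic (CCC.cccGraph (DihedralGroup n)) ↔ n = 3) ∧
      (CCC.IsCNSLHyperenergetic (CCC.cccGraph (DihedralGroup n)) ↔ Even n ∧ 20 ≤ n)) ∧
    -- the dicyclic groups `T_{4n}`
    (∀ (n : ℕ) [NeZero n], 2 ≤ n →
      ¬ CCC.IsCNLBorderenergetic (CCC.cccGraph (QuaternionGroup n)) ∧
      (CCC.IsCNLHyperenergetic (CCC.cccGraph (QuaternionGroup n)) ↔ 7 ≤ n) ∧
      ¬ CCC.IsCNSLBorderenergetic (CCC.cccGraph (QuaternionGroup n)) ∧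
      (CCC.IsCNSLHyperenergetic (CCC.cccGraph (QuaternionGroup n)) ↔ 10 ≤ n)) ∧
    -- the groups `U_{6n}`
    (∀ (n : ℕ) [NeZero n], 2 ≤ n →
      ¬ CCC.IsCNLBorderenergetic (CCC.cccGraph (CCC.GroupU6 n)) ∧
      ¬ CCC.IsCNLHyperenergetic (CCC.cccGraph (CCC.GroupU6 n)) ∧
      ¬ CCC.IsCNSLBorderenergetic (CCC.cccGraph (CCC.GroupU6 n)) ∧
      ¬ CCC.IsCNSLHyperenergetic (CCC.cccGraph (CCC.GroupU6 n))) ∧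
    -- the semidihedral groups `SD_{8n}`
    (∀ (n : ℕ) [NeZero n], 2 ≤ n →
      ¬ CCC.IsCNLBorderenergetic (CCC.cccGraph (CCC.GroupSD n)) ∧
      (CCC.IsCNLHyperenergetic (CCC.cccGraph (CCC.GroupSD n)) ↔ 4 ≤ n) ∧
      ¬ CCC.IsCNSLBorderenergetic (CCC.cccGraph (CCC.GroupSD n)) ∧
      (CCC.IsCNSLHyperenergetic (CCC.cccGraph (CCC.GroupSD n)) ↔ 6 ≤ n)) ∧
    -- the groups `U_{(n,m)}`
    (∀ (n m : ℕ) [NeZero n] [NeZero m], 2 ≤ n → 2 ≤ m →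
      (CCC.IsCNLBorderenergetic (CCC.cccGraph (CCC.GroupU n m)) ↔ m = 2) ∧
      (CCC.IsCNLHyperenergetic (CCC.cccGraph (CCC.GroupU n m)) ↔
        ¬ (m = 2 ∨ m = 3 ∨ (m = 5 ∧ (n = 2 ∨ n = 3)) ∨ m = 4 ∨ (m = 8 ∧ n = 2) ∨ m = 6)) ∧
      (CCC.IsCNSLBorderenergetic (CCC.cccGraph (CCC.GroupU n m)) ↔ m = 2) ∧
      (CCC.IsCNSLHyperenergetic (CCC.cccGraph (CCC.GroupU n m)) ↔
        ¬ (m = 2 ∨ m = 3 ∨ ((m = 5 ∨ m = 7 ∨ m = 9) ∧ n = 2) ∨ (m = 5 ∧ (n = 3 ∨ n = 4)) ∨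
          m = 4 ∨ (m = 8 ∧ n = 2) ∨ m = 6 ∨ (m = 10 ∧ n = 2)))) := by
  refine ⟨fun n _ => CCC.classification_dihedral n, fun n _ => CCC.classification_quaternion n,
    fun n _ hn => ?_, fun n _ => CCC.classification_semidihedral n, fun n m _ _ hn hm => ?_⟩
  -- By definition `GroupU6 n` is `GroupU n 3`.
  · obtain ⟨h1, h2, h3, h4⟩ := CCC.classification_groupU n 3 hn le_rfl
    exact ⟨h1, fun h => h2.mp h (by simp), h3, fun h => h4.mp h (by simp)⟩
  · obtain rfl | hm3 : m = 2 ∨ 3 ≤ m := by omega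
    · have := CCC.isEmpty_vertex_groupU_two n
      obtain ⟨h1, h2, h3, h4⟩ := CCC.classification_of_isEmpty (G := CCC.cccGraph (CCC.GroupU n 2))
      exact ⟨iff_of_true h1 rfl, iff_of_false h2 (by simp), iff_of_true h3 rfl,
        iff_of_false h4 (by simp)⟩
    · obtain ⟨h1, h2, h3, h4⟩ := CCC.classification_groupU n m hn hm3
      exact ⟨iff_of_false h1 (by omega), h2.trans (by omega), iff_of_false h3 (by omega),
        h4.trans (by omega)⟩
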